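/- Let $T\in(0,\infty)$, let $(\Omega,\mathcal F,\mathbb P)$ be a complete probability space, and let $X=(X_t)_{t\in[0,T]}$ be a real-valued Lévy process on it: $X_0=0$ a.s., $X$ has independent and stationary increments and càdlàg paths. Let $(\gamma,\sigma,\nu)$ be the characteristic triplet of $X$, that is, $\gamma\in\mathbb R$, $\sigma\ge 0$, $\nu$ is a Borel measure on $\mathbb R$ with $\nu(\{0\})=0$ and $\int_{\mathbb R}(x^2\wedge 1)\,\nu(\mathrm dx)<\infty$, and $\mathbb E\,\mathrm e^{\mathrm i uX_t}=\mathrm e^{-t\psi(u)}$ for all $u\in\mathbb R$ and $t\in[0,T]$, where $$\psi(z)=-\mathrm i\gamma z+\frac{\sigma^2z^2}{2}-\int_{\mathbb R}\bigl(\mathrm e^{\mathrm i zx}-1-\mathrm i zx\mathbf 1_{\{|x|\le 1\}}\bigr)\,\nu(\mathrm dx)$$ for every $z\in\mathbb C$ for which the integral converges absolutely. Let $(\mathcal F_t)_{t\in[0,T]}$ be the natural filtration of $X$ augmented by the $\mathbb P$-null sets. Put $S_t=\mathrm e^{X_t}$ and, for $\eta\in[0,1]$, $$\Phi(\eta)_t=S_t\,\sup_{u\in[0,t]}S_u^{\eta-1},\qquad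 t\in[0,T].$$ For $p\in(0,\infty)$ and a nonnegative càdlàg adapted process $\Phi=(\Phi_t)_{t\in[0,T]}$, let $\|\Phi\|_{\mathcal{SM}_p(\mathbb P)}$ be the infimum (with $\inf\emptyset=\infty$) of all real $c\ge 0$ such that, for every stopping time $\rho\colon\Omega\to[0,T]$, $$\mathbb E\Bigl[\sup_{\rho\le t\le T}\Phi_t^p\Bigm|\mathcal F_\rho\Bigr]\le c^p\,\Phi_\rho^p\quad\text{a.s.};$$ write $\Phi\in\mathcal{SM}_p(\mathbb P)$ if $\Phi$ is such a process and $\|\Phi\|_{\mathcal{SM}_p(\mathbb P)}<\infty$. Assume that $\int_{\{|x|>1\}}\mathrm e^{qx}\,\nu(\mathrm dx)<\infty$ for some $q\in(1,\infty)$. Then, for every $\eta\in[0,1]$, $\Phi(\eta)\in\mathcal{SM}_q(\mathbb P)$ and $$\|\Phi(\eta)\|_{\mathcal{SM}_q(\mathbb P)}^q\le \mathrm e^{T|\psi(-\mathrm i)|(2q+1)}\,2^{1-\eta}\Bigl(\frac{q}{q-1}\Bigr)^{2q}\,\|S_T\|_{L_q(\mathbb P)}^q .$$ -/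

import Mathlib

open MeasureTheory ProbabilityTheory Filter Topology
open scoped ENNReal NNReal

noncomputable section

namespace ExpLevy

/-- The time interval `[0, T]`. -/
abbrev Time (T : ℝ) : Type := Set.Icc (0 : ℝ) T

/-- A path on `[0, T]` is càdlàg: right-continuous with (finite) left limits. -/
def IsCadlagPath {T : ℝ} (f : Time T → ℝ) : Prop :=
  ∀ t, ContinuousWithinAt f (Set.Ici t) t ∧ ∃ l : ℝ, Tendsto f (𝓝[<] t) (𝓝 l)

/-- Real-valued Lévy processes on `[0, T]`: a process with càdlàg paths that starts in `0` and has
independent and stationary increments. -/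
structure IsLevyProcess {Ω : Type*} [MeasurableSpace Ω] {T : ℝ} (P : Measure Ω)
    (X : Time T → Ω → ℝ) : Prop where
  measurable : ∀ t, Measurable (X t)
  cadlag : ∀ ω, IsCadlagPath fun t => X t ω
  zero : ∀ t : Time T, (t : ℝ) = 0 → ∀ᵐ ω ∂P, X t ω = 0
  indep : HasIndepIncrements X P
  stationary : ∀ s t u v : Time T, s ≤ t → u ≤ v → (t : ℝ) - s = (v : ℝ) - u →
    IdentDistrib (fun ω => X t ω - X s ω) (fun ω => X v ω - X u ω) P P

/-- Lévy measures on `ℝ`: `ν({0}) = 0` and `∫ (x² ∧ 1) ν(dx) < ∞`. -/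
def IsLevyMeasure (ν : Measure ℝ) : Prop :=
  ν {0} = 0 ∧ ∫⁻ x, ENNReal.ofReal (min (x ^ 2) 1) ∂ν < ∞

/-- The function
`ψ(z) = - i γ z + σ² z² / 2 - ∫ (exp(i z x) - 1 - i z x 1_{|x| ≤ 1}) ν(dx)`
of a complex variable `z`, meaningful for those `z` (such as all real ones) for which the
integral converges. -/
def charExponent (γ σ : ℝ) (ν : Measure ℝ) (z : ℂ) : ℂ :=
  -Complex.I * γ * z + (σ : ℂ) ^ 2 * z ^ 2 / 2
    - ∫ x : ℝ, (Complex.exp (Complex.I * z * x) - 1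
        - (Set.Icc (-1 : ℝ) 1).indicator (fun y : ℝ => Complex.I * z * y) x) ∂ν

/-- `(γ, σ, ν)` is the characteristic triplet of the process `X`:
`E exp(i u X_t) = exp(- t ψ(u))` for all real `u` and all `t ∈ [0, T]`. -/
structure HasCharacteristicTriplet {Ω : Type*} [MeasurableSpace Ω] {T : ℝ} (P : Measure Ω)
    (X : Time T → Ω → ℝ) (γ σ : ℝ) (ν : Measure ℝ) : Prop where
  nonneg : 0 ≤ σ
  levyMeasure : IsLevyMeasure ν
  charFun_eq : ∀ (t : Time T) (u : ℝ),
    ∫ ω, Complex.exp (Complex.I * u * X t ω) ∂P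
      = Complex.exp (-((t : ℝ) : ℂ) * charExponent γ σ ν u)

/-- The augmented natural filtration of `X`: the `σ`-algebra at time `t` is generated by the
`X s`, `s ≤ t`, and by the `P`-null sets. -/
def augmentedFiltration {Ω : Type*} [mΩ : MeasurableSpace Ω] {T : ℝ} (P : Measure Ω)
    [P.IsComplete] (X : Time T → Ω → ℝ) (hX : ∀ t, Measurable (X t)) :
    Filtration (Time T) mΩ where
  seq t := (⨆ s ≤ t, MeasurableSpace.comap (X s) inferInstance)
    ⊔ MeasurableSpace.generateFrom {A | P A = 0}
  mono' _ _ hij := sup_le_sup_right (biSup_mono fun _ h => h.trans hij) _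
  le' _ := sup_le (iSup₂_le fun s _ => (hX s).comap_le)
    (MeasurableSpace.generateFrom_le fun _ hA => Measure.IsComplete.out' _ hA)

/-- The class `CL⁺([0, T])` of nonnegative càdlàg adapted processes. -/
structure IsCLPlus {Ω : Type*} [mΩ : MeasurableSpace Ω] {T : ℝ} (P : Measure Ω)
    (𝓕 : Filtration (Time T) mΩ) (Φ : Time T → Ω → ℝ) : Prop where
  adapted : Adapted 𝓕 Φ
  cadlag : ∀ ω, IsCadlagPath fun t => Φ t ω
  nonneg : ∀ᵐ ω ∂P, ∀ t, 0 ≤ Φ t ω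

/-- The norm `‖Φ‖_{SM_p(P)}`: the infimum of all `c ∈ [0, ∞)` such that, for every stopping time
`ρ : Ω → [0, T]`, `E[sup_{ρ ≤ t ≤ T} Φ_t^p | 𝓕_ρ] ≤ c^p Φ_ρ^p` almost surely, with `inf ∅ = ∞`.
The conditional expectation is the generalized one of `[0, ∞]`-valued random variables. -/
def smNorm {Ω : Type*} [mΩ : MeasurableSpace Ω] {T : ℝ} (P : Measure Ω)
    (𝓕 : Filtration (Time T) mΩ) (p : ℝ) (Φ : Time T → Ω → ℝ) : ℝ≥0∞ :=
  ⨅ (c : ℝ≥0) (_ : ∀ (ρ : Ω → Time T) (hρ : IsStoppingTime 𝓕 fun ω => (ρ ω : WithTop (Time T))),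
      ∀ᵐ ω ∂P,
        condLExp hρ.measurableSpace P
            (fun ω' => ⨆ (t : Time T) (_ : ρ ω' ≤ t), ENNReal.ofReal (Φ t ω' ^ p)) ω
          ≤ (c : ℝ≥0∞) ^ p * ENNReal.ofReal (Φ (ρ ω) ω ^ p)),
    (c : ℝ≥0∞)

/-- Membership in `SM_p(P)`. -/
def MemSM {Ω : Type*} [mΩ : MeasurableSpace Ω] {T : ℝ} (P : Measure Ω)
    (𝓕 : Filtration (Time T) mΩ) (p : ℝ) (Φ : Time T → Ω → ℝ) : Prop :=
  IsCLPlus P 𝓕 Φ ∧ smNorm P 𝓕 p Φ < ∞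

/-- The price process `S = exp(X)`. -/
def price {Ω : Type*} {T : ℝ} (X : Time T → Ω → ℝ) (t : Time T) (ω : Ω) : ℝ :=
  Real.exp (X t ω)

/-- The weight process `Φ(η)_t = S_t · sup_{u ∈ [0, t]} S_u^(η - 1)`. -/
def weight {Ω : Type*} {T : ℝ} (S : Time T → Ω → ℝ) (η : ℝ) (t : Time T) (ω : Ω) : ℝ :=
  S t ω * ⨆ u : Set.Iic t, S u ω ^ (η - 1)

end ExpLevy

end

/-! Pathwise, `weight_le` gives Φ_t ≤ Φ_s · sup_{s≤u≤t} S_t/S_u for s ≤ t. Hence sup_{t≥ρ} Φ_t^q ≤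
Φ_ρ^q · W, where W is the supremum of exp(q(X_t − X_u)) over ρ ≤ u ≤ t ≤ T. It remains to find a
constant D with E[W | F_ρ] ≤ D; then the q-th power of the norm is at most D.

To use independence of increments at a stopping time, W is majorised by a liminf of suprema over
grids (`futureSup`). On a grid, ρ is rounded up to one of finitely many points τ_k. The event that
it is rounded to τ_k belongs to F_{τ_k}, and the supremum from τ_k on is independent of that
σ-algebra. Enlarging it to the whole grid and applying Fatou's lemma reduces everything to the
expectation for a deterministic grid (`setLIntegral_futureSup_le`).

That expectation is bounded in `lintegral_gridSup_le`. Normalised to mean one, the exponentials of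
the grid increments are independent factors, and exp(X_t − X_u) becomes a product of consecutive
factors. For a fixed right end, let R_j be the largest product that ends there. Since R_{j+1} ≥ R_j
ξ_j, it is a submartingale, and Doob's L^q inequality removes the maximum over j. Reversing the
order of the factors turns R_N into a maximum of initial products, and Doob's inequality applies
again; hence the constant (q/(q−1))^{2q}. Undoing the normalisation costs exp(qT|ψ(−i)|) twice.

The normalisation needs E exp(qX_t) < ∞ and E exp(X_t), while only the characteristic function is
given. `exp_moments_of_charFun` approximates the law weakly by compound Poisson laws convolved with
Gaussian ones, whose transforms are explicit for 0 ≤ Re z ≤ q. Fatou's lemma gives the q-th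
exponential moment, and uniform integrability, from q > 1, the first. -/

namespace ExpLevy

/-! ### Compound Poisson laws and their exponential transforms. -/

section CompoundPoisson

/-- The `k`-fold convolution power of a measure on `ℝ`. -/
noncomputable def convPow (ρ : Measure ℝ) : ℕ → Measure ℝ
  | 0 => Measure.dirac 0
  | k + 1 => (convPow ρ k).conv ρ

/-- The compound Poisson law with intensity measure `ρ`. -/
noncomputable def compoundPoisson (ρ : Measure ℝ) : Measure ℝ :=
  ENNReal.ofReal (Real.exp (-ρ.real Set.univ)) •
    Measure.sum fun k => (ENNReal.ofReal ((k.factorial : ℝ)⁻¹)) • convPow ρ k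

instance (ρ : Measure ℝ) [IsFiniteMeasure ρ] (k : ℕ) : IsFiniteMeasure (convPow ρ k) := by
  induction k with
  | zero => unfold convPow; infer_instance
  | succ k ih => unfold convPow; infer_instance

theorem integrable_cexp_iff {μ : Measure ℝ} {z : ℂ} :
    Integrable (fun x : ℝ => Complex.exp (z * x)) μ ↔
      Integrable (fun x : ℝ => Real.exp (z.re * x)) μ := by
  rw [← integrable_norm_iff (by fun_prop)]
  simp [Complex.norm_exp]

theorem integrable_cexp_conv {μ ρ : Measure ℝ} [SFinite μ] [SFinite ρ] {z : ℂ}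
    (hμ : Integrable (fun x : ℝ => Complex.exp (z * x)) μ)
    (hρ : Integrable (fun x : ℝ => Complex.exp (z * x)) ρ) :
    Integrable (fun x : ℝ => Complex.exp (z * x)) (μ.conv ρ) := by
  rw [Measure.conv, integrable_map_measure (by fun_prop) (by fun_prop)]
  refine (hμ.mul_prod hρ).congr (ae_of_all _ fun p => ?_)
  simp [mul_add, Complex.exp_add]

theorem integral_cexp_conv {μ ρ : Measure ℝ} [SFinite μ] [SFinite ρ] {z : ℂ} :
    ∫ x : ℝ, Complex.exp (z * x) ∂(μ.conv ρ) =
      (∫ x : ℝ, Complex.exp (z * x) ∂μ) * ∫ x : ℝ, Complex.exp (z * x) ∂ρ := by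
  rw [Measure.conv, integral_map (by fun_prop) (by fun_prop), ← integral_prod_mul]
  simp [mul_add, Complex.exp_add]

variable {ρ : Measure ℝ} [IsFiniteMeasure ρ]

theorem integrable_cexp_convPow {z : ℂ} (h : Integrable (fun x : ℝ => Complex.exp (z * x)) ρ)
    (k : ℕ) : Integrable (fun x : ℝ => Complex.exp (z * x)) (convPow ρ k) := by
  induction k with
  | zero => exact integrable_dirac (by simp)
  | succ k ih => exact integrable_cexp_conv ih h

theorem integral_cexp_convPow (z : ℂ) (k : ℕ) :
    ∫ x : ℝ, Complex.exp (z * x) ∂(convPow ρ k) = (∫ x : ℝ, Complex.exp (z * x) ∂ρ) ^ k := by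
  induction k with
  | zero => simp [convPow]
  | succ k ih => rw [convPow, integral_cexp_conv, ih, pow_succ]

theorem integral_exp_convPow (s : ℝ) (k : ℕ) :
    ∫ x : ℝ, Real.exp (s * x) ∂(convPow ρ k) = (∫ x : ℝ, Real.exp (s * x) ∂ρ) ^ k := by
  have h := integral_cexp_convPow (ρ := ρ) s k
  have e : ∀ x : ℝ, Complex.exp (s * x) = ((Real.exp (s * x) : ℝ) : ℂ) := by intro x; simp
  simp_rw [e, integral_complex_ofReal] at h
  exact_mod_cast h

/-- The norm of the integrand depends only on `z.re`, so the norms of the terms add up to an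
exponential series. -/
theorem integrable_cexp_sum_convPow {z : ℂ}
    (h : Integrable (fun x : ℝ => Complex.exp (z * x)) ρ) :
    Integrable (fun x : ℝ => Complex.exp (z * x))
      (Measure.sum fun k => (ENNReal.ofReal ((k.factorial : ℝ)⁻¹)) • convPow ρ k) := by
  refine integrable_sum_measure
    (fun k => (integrable_cexp_convPow h k).smul_measure ENNReal.ofReal_ne_top) ?_
  have : ∀ k : ℕ, ∫ x : ℝ, ‖Complex.exp (z * x)‖ ∂((ENNReal.ofReal ((k.factorial : ℝ)⁻¹)) • convPow ρ k)
      = (∫ x : ℝ, Real.exp (z.re * x) ∂ρ) ^ k / k.factorial := by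
    intro k
    rw [integral_smul_measure, ENNReal.toReal_ofReal (by positivity)]
    simp only [Complex.norm_exp, Complex.mul_re, Complex.ofReal_re, Complex.ofReal_im, mul_zero,
      sub_zero, integral_exp_convPow, smul_eq_mul]
    rw [div_eq_inv_mul]
  simp_rw [this]
  exact Real.summable_pow_div_factorial _

theorem integrable_cexp_compoundPoisson {z : ℂ}
    (h : Integrable (fun x : ℝ => Complex.exp (z * x)) ρ) :
    Integrable (fun x : ℝ => Complex.exp (z * x)) (compoundPoisson ρ) :=
  (integrable_cexp_sum_convPow h).smul_measure ENNReal.ofReal_ne_top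

theorem integral_cexp_compoundPoisson {z : ℂ}
    (h : Integrable (fun x : ℝ => Complex.exp (z * x)) ρ) :
    ∫ x : ℝ, Complex.exp (z * x) ∂(compoundPoisson ρ) =
      Complex.exp (∫ x : ℝ, (Complex.exp (z * x) - 1) ∂ρ) := by
  rw [compoundPoisson, integral_smul_measure, integral_sum_measure (integrable_cexp_sum_convPow h),
    integral_sub h (integrable_const _), ENNReal.toReal_ofReal (by positivity),
    integral_const, sub_eq_add_neg, Complex.exp_add, mul_comm]
  have : ∀ k : ℕ, ∫ x : ℝ, Complex.exp (z * x) ∂((ENNReal.ofReal ((k.factorial : ℝ)⁻¹)) • convPow ρ k)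
      = (∫ x : ℝ, Complex.exp (z * x) ∂ρ) ^ k / k.factorial := by
    intro k
    rw [integral_smul_measure, ENNReal.toReal_ofReal (by positivity), integral_cexp_convPow,
      div_eq_inv_mul, Complex.real_smul]
    simp
  simp_rw [this]
  rw [Complex.real_smul, mul_comm, Complex.exp_eq_exp_ℂ,
    congrFun (NormedSpace.exp_eq_tsum_div (𝔸 := ℂ)) (∫ x : ℝ, NormedSpace.exp (z * x) ∂ρ),
    ← Complex.exp_eq_exp_ℂ]
  simp [mul_comm]

/-- The total mass is the transform at `z = 0`. -/
instance : IsProbabilityMeasure (compoundPoisson ρ) := by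
  have h0 : Integrable (fun x : ℝ => Complex.exp ((0 : ℂ) * x)) ρ := by
    simp
  have h1 := integrable_cexp_compoundPoisson h0
  have h2 := integral_cexp_compoundPoisson h0
  simp only [zero_mul, Complex.exp_zero] at h1 h2
  rw [integrable_const_iff] at h1
  have : IsFiniteMeasure (compoundPoisson ρ) := by simpa using h1
  refine ⟨?_⟩
  rw [← ENNReal.toReal_eq_one_iff]
  simpa [Measure.real] using h2

end CompoundPoisson

/-! ### Lévy–Khintchine cumulants and truncation of small jumps. -/

section Approximation

/-- The integrand of the Lévy–Khintchine formula for the moment generating function. -/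
noncomputable def levyKernel (z : ℂ) (x : ℝ) : ℂ :=
  Complex.exp (z * x) - 1 - (Set.Icc (-1 : ℝ) 1).indicator (fun y : ℝ => z * y) x

/-- The cumulant function `z ↦ γ z + σ² z² / 2 + ∫ (exp(z x) - 1 - z x 1_{|x| ≤ 1}) ν(dx)`. -/
noncomputable def levyCumulant (γ σ : ℝ) (ν : Measure ℝ) (z : ℂ) : ℂ :=
  γ * z + (σ : ℂ) ^ 2 * z ^ 2 / 2 + ∫ x : ℝ, levyKernel z x ∂ν

/-- In the variable of the cumulant, the strip `0 ≤ z.re ≤ q` contains both the imaginary axis,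
where characteristic functions live, and the real points 1 and `q` whose moments are wanted. -/
theorem levyCumulant_I_mul (γ σ : ℝ) (ν : Measure ℝ) (z : ℂ) :
    levyCumulant γ σ ν (Complex.I * z) = -charExponent γ σ ν z := by
  simp only [levyCumulant, charExponent, levyKernel, mul_pow, Complex.I_sq]
  ring

@[fun_prop]
theorem measurable_levyKernel (z : ℂ) : Measurable (levyKernel z) := by
  unfold levyKernel
  refine Measurable.sub (by fun_prop) (Measurable.indicator (by fun_prop) measurableSet_Icc)

/-- The complement of a small neighbourhood of `0`. -/
def bigJumps (n : ℕ) : Set ℝ := {x | 1 / ((n : ℝ) + 1) < |x|}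

theorem measurableSet_bigJumps (n : ℕ) : MeasurableSet (bigJumps n) :=
  measurableSet_lt measurable_const (by fun_prop)

variable {ν : Measure ℝ}

theorem IsLevyMeasure.integrable_min (h : IsLevyMeasure ν) :
    Integrable (fun x : ℝ => min (x ^ 2) 1) ν := by
  refine ⟨by fun_prop, ?_⟩
  rw [hasFiniteIntegral_iff_ofReal (ae_of_all _ fun x => by positivity)]
  exact h.2

theorem IsLevyMeasure.measure_bigJumps_lt_top (h : IsLevyMeasure ν) (n : ℕ) :
    ν (bigJumps n) < ∞ := by
  have h1 := h.integrable_min.measure_norm_ge_lt_top (ε := (1 / ((n : ℝ) + 1)) ^ 2) (by positivity)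
  refine (measure_mono fun x hx => ?_).trans_lt h1
  simp only [bigJumps, Set.mem_ofPred_eq] at hx ⊢
  have h0 : (0 : ℝ) < 1 / ((n : ℝ) + 1) := by positivity
  rw [Real.norm_of_nonneg (by positivity), le_min_iff]
  constructor
  · rw [← sq_abs x]; gcongr
  · have : 1 / ((n : ℝ) + 1) ≤ 1 := by
      rw [div_le_one (by positivity)]; simp
    exact pow_le_one₀ h0.le this

/-- Small jumps are controlled by the second-order Taylor remainder. For large jumps |exp(zx)| is at
most `exp(qx)` or at most 1, according to the sign of x; the constant 2 collects this 1 and the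
subtracted one. -/
theorem norm_levyKernel_le {q : ℝ} {z : ℂ} (hz : 0 ≤ z.re) (hzq : z.re ≤ q) (x : ℝ) :
    ‖levyKernel z x‖ ≤ (‖z‖ ^ 2 * Real.exp ‖z‖ + 2) * min (x ^ 2) 1
      + {x : ℝ | 1 < |x|}.indicator (fun x => Real.exp (q * x)) x := by
  by_cases hx : 1 < |x|
  · have hx' : x ∉ Set.Icc (-1 : ℝ) 1 := fun h => absurd (abs_le.2 h) (not_le.2 hx)
    have h2 : (1 : ℝ) ≤ x ^ 2 := by rw [← sq_abs]; nlinarith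
    rw [levyKernel, Set.indicator_of_notMem hx', sub_zero,
      Set.indicator_of_mem (show x ∈ {x : ℝ | 1 < |x|} from hx), min_eq_right h2, mul_one]
    have h3 : ‖Complex.exp (z * x)‖ ≤ Real.exp (q * x) + 1 := by
      rw [Complex.norm_exp]
      simp only [Complex.mul_re, Complex.ofReal_re, Complex.ofReal_im, mul_zero, sub_zero]
      rcases le_total 0 x with h | h
      · have : Real.exp (z.re * x) ≤ Real.exp (q * x) := by gcongr
        linarith
      · have : Real.exp (z.re * x) ≤ 1 := Real.exp_le_one_iff.2 (mul_nonpos_of_nonneg_of_nonpos hz h)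
        linarith [Real.exp_pos (q * x)]
    have h4 := norm_sub_le (Complex.exp (z * x)) 1
    rw [norm_one] at h4
    have h5 : 0 ≤ ‖z‖ ^ 2 * Real.exp ‖z‖ := by positivity
    linarith
  · have hx' : x ∈ Set.Icc (-1 : ℝ) 1 := abs_le.1 (not_lt.1 hx)
    have hx1 : |x| ≤ 1 := not_lt.1 hx
    have h2 : x ^ 2 ≤ 1 := by rw [← sq_abs]; exact pow_le_one₀ (abs_nonneg _) hx1
    rw [levyKernel, Set.indicator_of_mem hx',
      Set.indicator_of_notMem (show x ∉ {x : ℝ | 1 < |x|} from hx), min_eq_left h2, add_zero]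
    have h3 := Complex.norm_exp_sub_sum_le_norm_mul_exp (z * x) 2
    have h4 : ‖z * x‖ ≤ ‖z‖ := by
      rw [norm_mul, Complex.norm_real, Real.norm_eq_abs]
      exact mul_le_of_le_one_right (norm_nonneg _) hx1
    calc ‖Complex.exp (z * x) - 1 - z * x‖
        = ‖Complex.exp (z * x) - ∑ m ∈ Finset.range 2, (z * x) ^ m / (m.factorial : ℂ)‖ := by
          congr 1; simp [Finset.sum_range_succ]; ring
      _ ≤ ‖z * x‖ ^ 2 * Real.exp ‖z * x‖ := h3
      _ ≤ (‖z‖ ^ 2 * x ^ 2) * Real.exp ‖z‖ := by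
          rw [norm_mul z, mul_pow, Complex.norm_real, Real.norm_eq_abs, sq_abs]
          rw [norm_mul, Complex.norm_real, Real.norm_eq_abs] at h4
          gcongr
      _ ≤ (‖z‖ ^ 2 * Real.exp ‖z‖ + 2) * x ^ 2 := by nlinarith [sq_nonneg x]

variable {q : ℝ}

theorem integrable_levyKernel_bound (hL : IsLevyMeasure ν)
    (hν : ∫⁻ x in {x : ℝ | 1 < |x|}, ENNReal.ofReal (Real.exp (q * x)) ∂ν < ∞) (c : ℝ) :
    Integrable (fun x => c * min (x ^ 2) 1
      + {x : ℝ | 1 < |x|}.indicator (fun x => Real.exp (q * x)) x) ν := by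
  refine (hL.integrable_min.const_mul c).add ?_
  rw [integrable_indicator_iff (measurableSet_lt measurable_const (by fun_prop))]
  refine ⟨by fun_prop, ?_⟩
  rw [hasFiniteIntegral_iff_ofReal (ae_of_all _ fun x => by positivity)]
  exact hν

theorem integrable_levyKernel (hL : IsLevyMeasure ν)
    (hν : ∫⁻ x in {x : ℝ | 1 < |x|}, ENNReal.ofReal (Real.exp (q * x)) ∂ν < ∞)
    {z : ℂ} (hz : 0 ≤ z.re) (hzq : z.re ≤ q) : Integrable (levyKernel z) ν :=
  (integrable_levyKernel_bound hL hν _).mono' (by fun_prop)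
    (ae_of_all _ fun x => norm_levyKernel_le hz hzq x)

theorem tendsto_levyCumulant_restrict (γ σ : ℝ) (hL : IsLevyMeasure ν)
    (hν : ∫⁻ x in {x : ℝ | 1 < |x|}, ENNReal.ofReal (Real.exp (q * x)) ∂ν < ∞)
    {z : ℂ} (hz : 0 ≤ z.re) (hzq : z.re ≤ q) :
    Tendsto (fun n => levyCumulant γ σ (ν.restrict (bigJumps n)) z) atTop
      (𝓝 (levyCumulant γ σ ν z)) := by
  unfold levyCumulant
  refine Tendsto.const_add _ ?_
  simp_rw [← fun n => integral_indicator (μ := ν) (f := levyKernel z) (measurableSet_bigJumps n)]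
  refine tendsto_integral_of_dominated_convergence _
    (fun n => ((measurable_levyKernel z).indicator (measurableSet_bigJumps n)).aestronglyMeasurable)
    (integrable_levyKernel_bound hL hν _)
    (fun n => ae_of_all _ fun x =>
      (norm_indicator_le_norm_self _ _).trans (norm_levyKernel_le hz hzq x))
    (ae_of_all _ fun x => ?_)
  -- The sets `bigJumps n` exhaust only the complement of 0, but the kernel vanishes at 0.
  rcases eq_or_ne x 0 with rfl | hx
  · have h0 : levyKernel z 0 = 0 := by simp [levyKernel]
    simp_rw [fun n => Set.indicator_apply_eq_zero.2 fun _ : (0 : ℝ) ∈ bigJumps n => h0, h0]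
    exact tendsto_const_nhds
  · refine tendsto_const_nhds.congr' ?_
    have h1 : Tendsto (fun n : ℕ => 1 / ((n : ℝ) + 1)) atTop (𝓝 0) :=
      tendsto_one_div_add_atTop_nhds_zero_nat
    filter_upwards [h1.eventually (gt_mem_nhds (abs_pos.2 hx))] with n hn
    rw [Set.indicator_of_mem (show x ∈ bigJumps n from hn)]

/-- Laws with compound Poisson and Gaussian part that approximate the infinitely divisible law
with cumulant function `t * levyCumulant γ σ ν`. -/
noncomputable def levyApprox (γ σ : ℝ) (ν : Measure ℝ) (t : ℝ≥0) (n : ℕ) : Measure ℝ :=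
  (compoundPoisson ((t : ℝ≥0∞) • ν.restrict (bigJumps n))).conv
    (gaussianReal (t * (γ - ∫ x in bigJumps n, (Set.Icc (-1 : ℝ) 1).indicator (fun y => y) x ∂ν))
      (Real.toNNReal (t * σ ^ 2)))

theorem isProbabilityMeasure_levyApprox (γ σ : ℝ) (hL : IsLevyMeasure ν) (t : ℝ≥0) (n : ℕ) :
    IsProbabilityMeasure (levyApprox γ σ ν t n) := by
  have : IsFiniteMeasure (ν.restrict (bigJumps n)) :=
    ⟨by simpa using hL.measure_bigJumps_lt_top n⟩
  have : IsFiniteMeasure ((t : ℝ≥0∞) • ν.restrict (bigJumps n)) :=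
    Measure.smul_finite _ ENNReal.coe_ne_top
  unfold levyApprox
  infer_instance

/-- The compound Poisson part contributes the uncompensated integral of exp(zx) − 1. The correction
in the Gaussian mean supplies exactly the missing compensator, which is finite because the truncated
measure is. -/
theorem integrable_integral_cexp_levyApprox (γ σ : ℝ) (hL : IsLevyMeasure ν)
    (hν : ∫⁻ x in {x : ℝ | 1 < |x|}, ENNReal.ofReal (Real.exp (q * x)) ∂ν < ∞)
    (t : ℝ≥0) (n : ℕ) {z : ℂ} (hz : 0 ≤ z.re) (hzq : z.re ≤ q) :
    Integrable (fun x : ℝ => Complex.exp (z * x)) (levyApprox γ σ ν t n) ∧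
    ∫ x : ℝ, Complex.exp (z * x) ∂(levyApprox γ σ ν t n) =
      Complex.exp (t * levyCumulant γ σ (ν.restrict (bigJumps n)) z) := by
  have hf : IsFiniteMeasure (ν.restrict (bigJumps n)) :=
    ⟨by simpa using hL.measure_bigJumps_lt_top n⟩
  have : IsFiniteMeasure ((t : ℝ≥0∞) • ν.restrict (bigJumps n)) :=
    Measure.smul_finite _ ENNReal.coe_ne_top
  have hi : Integrable (fun x : ℝ => (Set.Icc (-1 : ℝ) 1).indicator (fun y => y) x)
      (ν.restrict (bigJumps n)) := by
    refine Integrable.of_bound (C := 1) ((measurable_id.indicator measurableSet_Icc).aestronglyMeasurable)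
      (ae_of_all _ fun x => ?_)
    by_cases hx : x ∈ Set.Icc (-1 : ℝ) 1
    · rw [Set.indicator_of_mem hx]; exact abs_le.2 hx
    · rw [Set.indicator_of_notMem hx]; simp
  have e : ∀ x : ℝ, Complex.exp (z * x) - 1 = levyKernel z x
      + z * (((Set.Icc (-1 : ℝ) 1).indicator (fun y => y) x : ℝ) : ℂ) := by
    intro x
    by_cases hx : x ∈ Set.Icc (-1 : ℝ) 1
    · simp [levyKernel, Set.indicator_of_mem hx]
    · simp [levyKernel, Set.indicator_of_notMem hx]
  have hk : Integrable (levyKernel z) (ν.restrict (bigJumps n)) :=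
    (integrable_levyKernel hL hν hz hzq).restrict
  have h1 : Integrable (fun x : ℝ => Complex.exp (z * x) - 1) (ν.restrict (bigJumps n)) := by
    simp_rw [e]
    exact hk.add (hi.ofReal.const_mul z)
  have h2 : Integrable (fun x : ℝ => Complex.exp (z * x))
      ((t : ℝ≥0∞) • ν.restrict (bigJumps n)) := by
    refine Integrable.smul_measure ?_ ENNReal.coe_ne_top
    exact (h1.add (integrable_const (1 : ℂ))).congr (ae_of_all _ fun x => by simp)
  have h3 : ∫ x : ℝ, (Complex.exp (z * x) - 1) ∂(ν.restrict (bigJumps n)) =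
      ∫ x, levyKernel z x ∂(ν.restrict (bigJumps n))
        + z * ((∫ x in bigJumps n, (Set.Icc (-1 : ℝ) 1).indicator (fun y => y) x ∂ν : ℝ) : ℂ) := by
    simp_rw [e]
    have hi' : Integrable (fun x : ℝ => z * (((Set.Icc (-1 : ℝ) 1).indicator (fun y => y) x : ℝ) : ℂ))
        (ν.restrict (bigJumps n)) := (hi.ofReal (𝕜 := ℂ)).const_mul z
    rw [integral_add hk hi', integral_const_mul, integral_complex_ofReal]
  constructor
  · refine integrable_cexp_conv (integrable_cexp_compoundPoisson h2) ?_
    rw [integrable_cexp_iff]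
    exact integrable_exp_mul_gaussianReal _
  · rw [levyApprox, integral_cexp_conv, integral_cexp_compoundPoisson h2]
    have h4 := complexMGF_id_gaussianReal
      (μ := t * (γ - ∫ x in bigJumps n, (Set.Icc (-1 : ℝ) 1).indicator (fun y => y) x ∂ν))
      (v := Real.toNNReal (t * σ ^ 2)) z
    simp only [complexMGF, id] at h4
    rw [h4, ← Complex.exp_add, integral_smul_measure, h3, levyCumulant]
    congr 1
    rw [Real.coe_toNNReal _ (by positivity), ENNReal.coe_toReal, Complex.real_smul]
    push_cast
    ring

end Approximation

/-! ### Exponential moments as limits along the approximating laws. -/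

section ExponentialMoments

variable {ν : Measure ℝ} {q : ℝ}

theorem tendsto_levyApprox (γ σ : ℝ) (hL : IsLevyMeasure ν) (hq : 0 ≤ q)
    (hν : ∫⁻ x in {x : ℝ | 1 < |x|}, ENNReal.ofReal (Real.exp (q * x)) ∂ν < ∞) (t : ℝ≥0)
    (μ : ProbabilityMeasure ℝ)
    (hμ : ∀ u : ℝ, charFun (μ : Measure ℝ) u
      = Complex.exp (t * levyCumulant γ σ ν (Complex.I * u))) :
    Tendsto (β := ProbabilityMeasure ℝ)
      (fun n => ⟨levyApprox γ σ ν t n, isProbabilityMeasure_levyApprox γ σ hL t n⟩)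
      atTop (𝓝 μ) := by
  refine ProbabilityMeasure.tendsto_of_tendsto_charFun fun u => ?_
  rw [hμ]
  have hz : (Complex.I * u).re = 0 := by simp
  have h : ∀ n, charFun (levyApprox γ σ ν t n) u
      = Complex.exp (t * levyCumulant γ σ (ν.restrict (bigJumps n)) (Complex.I * u)) := by
    intro n
    rw [← (integrable_integral_cexp_levyApprox γ σ hL hν t n hz.ge (hz.trans_le hq)).2,
      charFun_apply_real]
    refine integral_congr_ae (ae_of_all _ fun x => ?_)
    simp only
    ring_nf
  simp only [ProbabilityMeasure.coe_mk, h]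
  exact (Complex.continuous_exp.tendsto _).comp
    ((tendsto_levyCumulant_restrict γ σ hL hν hz.ge (hz.trans_le hq)).const_mul _)

theorem integral_exp_levyApprox (γ σ : ℝ) (hL : IsLevyMeasure ν)
    (hν : ∫⁻ x in {x : ℝ | 1 < |x|}, ENNReal.ofReal (Real.exp (q * x)) ∂ν < ∞)
    (t : ℝ≥0) {s : ℝ} (hs : 0 ≤ s) (hsq : s ≤ q) :
    (∀ n, Integrable (fun x => Real.exp (s * x)) (levyApprox γ σ ν t n)) ∧
    Tendsto (fun n => ((∫ x, Real.exp (s * x) ∂(levyApprox γ σ ν t n) : ℝ) : ℂ)) atTop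
      (𝓝 (Complex.exp (t * levyCumulant γ σ ν s))) := by
  have h := fun n => integrable_integral_cexp_levyApprox γ σ hL hν t n (z := s)
    (by simpa using hs) (by simpa using hsq)
  refine ⟨fun n => by simpa using integrable_cexp_iff.1 (h n).1, ?_⟩
  have e : ∀ n, ((∫ x, Real.exp (s * x) ∂(levyApprox γ σ ν t n) : ℝ) : ℂ)
      = Complex.exp (t * levyCumulant γ σ (ν.restrict (bigJumps n)) s) := by
    intro n
    rw [← (h n).2, ← integral_complex_ofReal]
    simp
  simp_rw [e]
  exact (Complex.continuous_exp.tendsto _).comp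
    ((tendsto_levyCumulant_restrict γ σ hL hν (by simpa using hs) (by simpa using hsq)).const_mul _)

/-- Fatou's lemma for weak convergence, from the portmanteau inequality on open sets; `f` may be
unbounded. -/
theorem lintegral_le_of_tendsto_of_bounded {μs : ℕ → ProbabilityMeasure ℝ}
    {μ : ProbabilityMeasure ℝ} (h : Tendsto μs atTop (𝓝 μ)) {f : ℝ → ℝ} (hf : Continuous f)
    (hf0 : 0 ≤ f) {C : ℝ≥0∞} (hC : ∀ n, ∫⁻ x, ENNReal.ofReal (f x) ∂(μs n : Measure ℝ) ≤ C) :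
    ∫⁻ x, ENNReal.ofReal (f x) ∂(μ : Measure ℝ) ≤ C := by
  refine (lintegral_le_liminf_lintegral_of_forall_isOpen_measure_le_liminf_measure hf hf0
    fun G hG => ProbabilityMeasure.le_liminf_measure_open_of_tendsto h hG).trans ?_
  exact liminf_le_of_le (by isBoundedDefault) fun b hb => by
    obtain ⟨n, hn⟩ := hb.exists
    exact hn.trans (hC n)

/-- Where exp x exceeds K, the surplus power exp((q − 1)x) is at least K^(q−1). Since q > 1,
truncation at K therefore costs little, uniformly over laws with bounded q-th exponential moment. -/
theorem exp_sub_min_le (hq : 1 < q) {K : ℝ} (hK : 0 < K) (x : ℝ) :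
    Real.exp x - min (Real.exp x) K ≤ K ^ (1 - q) * Real.exp (q * x) := by
  rcases le_total (Real.exp x) K with h | h
  · rw [min_eq_left h, sub_self]; positivity
  · rw [min_eq_right h]
    have h1 : K ^ (q - 1) ≤ Real.exp x ^ (q - 1) := Real.rpow_le_rpow hK.le h (by linarith)
    have h2 : Real.exp (q * x) = Real.exp x ^ (q - 1) * Real.exp x := by
      rw [← Real.exp_mul, ← Real.exp_add]; ring_nf
    have h3 : K ^ (1 - q) * K ^ (q - 1) = 1 := by
      rw [← Real.rpow_add hK]; simp
    calc Real.exp x - K ≤ 1 * Real.exp x := by linarith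
      _ = K ^ (1 - q) * (K ^ (q - 1) * Real.exp x) := by rw [← mul_assoc, h3]
      _ ≤ K ^ (1 - q) * Real.exp (q * x) := by rw [h2]; gcongr

theorem integral_exp_sub_min_le {μ : Measure ℝ} [IsProbabilityMeasure μ] (hq : 1 < q)
    (hi : Integrable (fun x => Real.exp (q * x)) μ) {C : ℝ}
    (hC : ∫ x, Real.exp (q * x) ∂μ ≤ C) {K : ℝ} (hK : 0 < K) :
    Integrable (fun x => Real.exp x) μ ∧
    |∫ x, Real.exp x ∂μ - ∫ x, min (Real.exp x) K ∂μ| ≤ K ^ (1 - q) * C := by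
  have h1 : Integrable (fun x => Real.exp x) μ := by
    refine (hi.add (integrable_const (1 : ℝ))).mono' (by fun_prop) (ae_of_all _ fun x => ?_)
    rw [Real.norm_of_nonneg (Real.exp_nonneg _)]
    simp only [Pi.add_apply]
    rcases le_total 0 x with h | h
    · have : Real.exp x ≤ Real.exp (q * x) := Real.exp_le_exp.2 (by nlinarith)
      linarith
    · have := Real.exp_le_one_iff.2 h
      linarith [Real.exp_pos (q * x)]
  have h2 : Integrable (fun x => min (Real.exp x) K) μ := h1.inf (integrable_const K)
  refine ⟨h1, ?_⟩
  rw [← integral_sub h1 h2, abs_of_nonneg (integral_nonneg fun x => by simp)]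
  calc _ ≤ ∫ x, K ^ (1 - q) * Real.exp (q * x) ∂μ :=
        integral_mono (h1.sub h2) (hi.const_mul _) fun x => exp_sub_min_le hq hK x
    _ ≤ K ^ (1 - q) * C := by rw [integral_const_mul]; gcongr

/-- Exponential moments of an infinitely divisible law, from those of its Lévy measure. -/
theorem exp_moments_of_charFun (γ σ : ℝ) (hL : IsLevyMeasure ν) (hq : 1 < q)
    (hν : ∫⁻ x in {x : ℝ | 1 < |x|}, ENNReal.ofReal (Real.exp (q * x)) ∂ν < ∞) (t : ℝ≥0)
    (μ : Measure ℝ) [hp : IsProbabilityMeasure μ]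
    (hμ : ∀ u : ℝ, charFun μ u = Complex.exp (t * levyCumulant γ σ ν (Complex.I * u))) :
    Integrable (fun x => Real.exp (q * x)) μ ∧
    ((∫ x, Real.exp x ∂μ : ℝ) : ℂ) = Complex.exp (t * levyCumulant γ σ ν 1) := by
  have hq0 : 0 ≤ q := by linarith
  have hpn := isProbabilityMeasure_levyApprox γ σ hL t
  have hw := tendsto_levyApprox γ σ hL hq0 hν t ⟨μ, hp⟩ hμ
  obtain ⟨hiq, htq⟩ := integral_exp_levyApprox γ σ hL hν t hq0 le_rfl
  obtain ⟨hi1, ht1⟩ := integral_exp_levyApprox γ σ hL hν t zero_le_one hq.le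
  have htq' := (Complex.continuous_re.tendsto _).comp htq
  simp only [Function.comp_def, Complex.ofReal_re] at htq'
  -- The q-th exponential moments of the approximating laws converge, hence are bounded by one C.
  obtain ⟨C, hC⟩ := htq'.bddAbove_range
  have hC' : ∀ n, ∫ x, Real.exp (q * x) ∂(levyApprox γ σ ν t n) ≤ C := fun n =>
    hC (Set.mem_range_self n)
  have hbound : ∫⁻ x, ENNReal.ofReal (Real.exp (q * x)) ∂μ ≤ ENNReal.ofReal C := by
    refine lintegral_le_of_tendsto_of_bounded hw (by fun_prop) (fun x => by positivity) fun n => ?_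
    simp only [ProbabilityMeasure.coe_mk]
    rw [← ofReal_integral_eq_lintegral_ofReal (hiq n) (ae_of_all _ fun x => by positivity)]
    exact ENNReal.ofReal_le_ofReal (hC' n)
  have hiμ : Integrable (fun x => Real.exp (q * x)) μ := by
    refine ⟨by fun_prop, ?_⟩
    rw [hasFiniteIntegral_iff_ofReal (ae_of_all _ fun x => by positivity)]
    exact hbound.trans_lt ENNReal.ofReal_lt_top
  have hC0 : 0 ≤ C := (integral_nonneg fun x => by positivity).trans (hC' 0)
  have hCμ : ∫ x, Real.exp (q * x) ∂μ ≤ C := by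
    rw [← ofReal_integral_eq_lintegral_ofReal hiμ (ae_of_all _ fun x => by positivity)] at hbound
    exact (ENNReal.ofReal_le_ofReal_iff hC0).1 hbound
  refine ⟨hiμ, ?_⟩
  suffices Tendsto (fun n => ∫ x, Real.exp x ∂(levyApprox γ σ ν t n)) atTop
      (𝓝 (∫ x, Real.exp x ∂μ)) by
    simp only [Complex.ofReal_one, one_mul] at ht1
    exact tendsto_nhds_unique ((Complex.continuous_ofReal.tendsto _).comp this) ht1
  have hKlim : Tendsto (fun K : ℝ => K ^ (1 - q) * C) atTop (𝓝 0) := by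
    have := (tendsto_rpow_neg_atTop (sub_pos.2 hq)).mul_const C
    simpa using this
  rw [Metric.tendsto_atTop]
  intro ε hε
  -- One third of ε for truncating under the approximating law, one for truncating under the limit,
  -- one for weak convergence tested on the truncated exponential.
  obtain ⟨K, hK, hK0⟩ := ((hKlim.eventually (gt_mem_nhds (show 0 < ε / 3 by positivity))).and
    (eventually_gt_atTop 0)).exists
  let f : BoundedContinuousFunction ℝ ℝ :=
    BoundedContinuousFunction.ofNormedAddCommGroup (fun x => min (Real.exp x) K) (by fun_prop) K
      fun x => by
        rw [Real.norm_of_nonneg (le_min (Real.exp_nonneg _) hK0.le)]; exact min_le_right _ _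
  have hf := Metric.tendsto_atTop.1
    (ProbabilityMeasure.tendsto_iff_forall_integral_tendsto.1 hw f) (ε / 3) (by positivity)
  obtain ⟨N, hN⟩ := hf
  refine ⟨N, fun n hn => ?_⟩
  have h1 := (integral_exp_sub_min_le hq (hiq n) (hC' n) hK0).2
  have h2 := (integral_exp_sub_min_le hq hiμ hCμ hK0).2
  have h3 := hN n hn
  simp only [ProbabilityMeasure.coe_mk, f, BoundedContinuousFunction.coe_ofNormedAddCommGroup,
    Real.dist_eq] at h3 ⊢
  rw [abs_lt] at *
  rw [abs_le] at h1 h2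
  constructor <;> linarith

end ExponentialMoments

/-! ### Doob's maximal inequality, derived pathwise. -/

section Doob

/-- Young's inequality for y · x^(q−1). It serves for a step in which the running maximum rises from
x to y. -/
theorem rpow_sub_rpow_le {q : ℝ} (hq : 1 < q) {x y : ℝ} (hx : 0 ≤ x) (hxy : x ≤ y) :
    y ^ q - x ^ q ≤ q / (q - 1) * (y * (y ^ (q - 1) - x ^ (q - 1))) := by
  have hq1 : 0 < q - 1 := by linarith
  have hy : 0 ≤ y := hx.trans hxy
  have key : q * (y * x ^ (q - 1)) ≤ y ^ q + (q - 1) * x ^ q := by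
    have h := Real.young_inequality_of_nonneg (a := y) (b := x ^ (q - 1)) (p := q)
      (q := q / (q - 1)) hy (Real.rpow_nonneg hx _) (Real.HolderConjugate.conjExponent hq)
    rw [← Real.rpow_mul hx, mul_div_cancel₀ _ hq1.ne'] at h
    have := mul_le_mul_of_nonneg_left h (by linarith : 0 ≤ q)
    calc q * (y * x ^ (q - 1)) ≤ q * (y ^ q / q + x ^ q / (q / (q - 1))) := this
      _ = _ := by field_simp
  have hyq : y * y ^ (q - 1) = y ^ q := by
    rw [← Real.rpow_one_add' hy (by linarith)]; ring_nf
  have e : q * (y * (y ^ (q - 1) - x ^ (q - 1))) = q * y ^ q - q * (y * x ^ (q - 1)) := by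
    rw [← hyq]; ring
  rw [div_mul_eq_mul_div, le_div_iff₀ hq1, e]
  linarith

/-- Summation by parts: the running maximum either stays constant or rises to the current value `s
(n + 1)`. -/
theorem rpow_partialSups_add_sum_le {q : ℝ} (hq : 1 < q) {s : ℕ → ℝ} (hs : ∀ n, 0 ≤ s n) (n : ℕ) :
    partialSups s n ^ q
      + q / (q - 1) * ∑ i ∈ Finset.range n, partialSups s i ^ (q - 1) * (s (i + 1) - s i)
      ≤ q / (q - 1) * (partialSups s n ^ (q - 1) * s n) := by
  have h0 : ∀ n, 0 ≤ partialSups s n := fun n => (hs n).trans (le_partialSups s n)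
  induction n with
  | zero =>
    have : s 0 ^ (q - 1) * s 0 = s 0 ^ q := by
      rw [← Real.rpow_add_one' (hs 0) (by linarith)]; ring_nf
    simp only [Finset.range_zero, Finset.sum_empty, mul_zero, add_zero, partialSups_zero, this]
    refine le_mul_of_one_le_left (Real.rpow_nonneg (hs 0) _) ?_
    rw [one_le_div (by linarith)]; linarith
  | succ n ih =>
    rw [Finset.sum_range_succ]
    have hstep : partialSups s (n + 1) ^ q - partialSups s n ^ q ≤
        q / (q - 1) * (s (n + 1) * (partialSups s (n + 1) ^ (q - 1) - partialSups s n ^ (q - 1))) := by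
      rcases le_total (s (n + 1)) (partialSups s n) with h | h
      · rw [partialSups_add_one, sup_of_le_left h]; simp
      · rw [partialSups_add_one, sup_of_le_right h]
        exact rpow_sub_rpow_le hq (h0 n) h
    linarith

/-- Pathwise form of Doob's maximal inequality. -/
theorem rpow_partialSups_le {q : ℝ} (hq : 1 < q) {s : ℕ → ℝ} (hs : ∀ n, 0 ≤ s n) (n : ℕ) :
    partialSups s n ^ q
      + q * (q / (q - 1)) * ∑ i ∈ Finset.range n, partialSups s i ^ (q - 1) * (s (i + 1) - s i)
      ≤ (q / (q - 1)) ^ q * s n ^ q := by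
  have hq1 : 0 < q - 1 := by linarith
  have h0 : 0 ≤ partialSups s n := (hs n).trans (le_partialSups s n)
  have h1 := rpow_partialSups_add_sum_le hq hs n
  set c := q / (q - 1) with hc
  have hc0 : 0 ≤ c := by positivity
  -- Young's inequality spends q − 1 of the q copies of the maximum's q-th power that `h1` provides
  -- after multiplication by q; one copy survives on the left.
  have h2 : q * (c * (partialSups s n ^ (q - 1) * s n))
      ≤ c ^ q * s n ^ q + (q - 1) * partialSups s n ^ q := by
    have h := Real.young_inequality_of_nonneg (a := c * s n) (b := partialSups s n ^ (q - 1))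
      (p := q) (q := q / (q - 1)) (mul_nonneg hc0 (hs n)) (Real.rpow_nonneg h0 _)
      (Real.HolderConjugate.conjExponent hq)
    rw [← Real.rpow_mul h0, mul_div_cancel₀ _ hq1.ne', Real.mul_rpow hc0 (hs n)] at h
    have := mul_le_mul_of_nonneg_left h (by linarith : 0 ≤ q)
    calc q * (c * (partialSups s n ^ (q - 1) * s n))
        = q * (c * s n * partialSups s n ^ (q - 1)) := by ring
      _ ≤ q * (c ^ q * s n ^ q / q + partialSups s n ^ q / (q / (q - 1))) := this
      _ = _ := by field_simp
  have h3 := mul_le_mul_of_nonneg_left h1 (by linarith : 0 ≤ q)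
  linarith

variable {Ω : Type*} [MeasurableSpace Ω] {P : Measure Ω}

theorem measurable_partialSups {s : ℕ → Ω → ℝ} (hs : ∀ n, Measurable (s n)) (n : ℕ) :
    Measurable fun ω => partialSups (fun i => s i ω) n := by
  induction n with
  | zero => simpa using hs 0
  | succ n ih =>
    simp only [partialSups_add_one]
    exact ih.sup (hs _)

theorem integrable_rpow_partialSups {q : ℝ} {s : ℕ → Ω → ℝ}
    (hs : ∀ n, Measurable (s n))
    (hs0 : ∀ n ω, 0 ≤ s n ω) (hi : ∀ n, Integrable (fun ω => s n ω ^ q) P) (n : ℕ) :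
    Integrable (fun ω => partialSups (fun i => s i ω) n ^ q) P := by
  induction n with
  | zero => simpa using hi 0
  | succ n ih =>
    refine (ih.add (hi (n + 1))).mono'
      ((measurable_partialSups hs _).pow_const q).aestronglyMeasurable (ae_of_all _ fun ω => ?_)
    have h0 : ∀ n, 0 ≤ partialSups (fun i => s i ω) n := fun n =>
      (hs0 n ω).trans (le_partialSups (fun i => s i ω) n)
    rw [Real.norm_of_nonneg (Real.rpow_nonneg (h0 _) _), partialSups_add_one]
    simp only [Pi.add_apply]
    rcases le_total (s (n + 1) ω) (partialSups (fun i => s i ω) n) with h | h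
    · rw [sup_of_le_left h]; linarith [Real.rpow_nonneg (hs0 (n + 1) ω) q]
    · rw [sup_of_le_right h]; linarith [Real.rpow_nonneg (h0 n) q]

theorem rpow_sub_one_mul_le {q : ℝ} (hq : 1 < q) {a b : ℝ} (ha : 0 ≤ a) (hb : 0 ≤ b) :
    a ^ (q - 1) * b ≤ a ^ q + b ^ q := by
  have e : ∀ x : ℝ, 0 ≤ x → x ^ (q - 1) * x = x ^ q := fun x hx => by
    rw [← Real.rpow_add_one' hx (by linarith)]; ring_nf
  rcases le_total a b with h | h
  · have : a ^ (q - 1) * b ≤ b ^ (q - 1) * b := by gcongr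
    linarith [e b hb, Real.rpow_nonneg ha q]
  · have : a ^ (q - 1) * b ≤ a ^ (q - 1) * a := by gcongr
    linarith [e a ha, Real.rpow_nonneg hb q]

theorem integrable_rpow_sub_one_mul {q : ℝ} (hq : 1 < q) {f g : Ω → ℝ} (hf : Measurable f)
    (hg : Measurable g) (hf0 : ∀ ω, 0 ≤ f ω) (hg0 : ∀ ω, 0 ≤ g ω)
    (hfi : Integrable (fun ω => f ω ^ q) P) (hgi : Integrable (fun ω => g ω ^ q) P) :
    Integrable (fun ω => f ω ^ (q - 1) * g ω) P := by
  refine (hfi.add hgi).mono' ((hf.pow_const _).mul hg).aestronglyMeasurable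
    (ae_of_all _ fun ω => ?_)
  rw [Real.norm_of_nonneg (mul_nonneg (Real.rpow_nonneg (hf0 ω) _) (hg0 ω))]
  exact rpow_sub_one_mul_le hq (hf0 ω) (hg0 ω)

/-- Doob's `L^q` maximal inequality for a finite sequence, under the weak form of the submartingale
property that its proof uses. -/
theorem integral_rpow_partialSups_le {q : ℝ} (hq : 1 < q) {s : ℕ → Ω → ℝ}
    (hs : ∀ n, Measurable (s n)) (hs0 : ∀ n ω, 0 ≤ s n ω)
    (hi : ∀ n, Integrable (fun ω => s n ω ^ q) P)
    (hsub : ∀ n, 0 ≤ ∫ ω, partialSups (fun i => s i ω) n ^ (q - 1) * (s (n + 1) ω - s n ω) ∂P)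
    (n : ℕ) :
    ∫ ω, partialSups (fun i => s i ω) n ^ q ∂P ≤ (q / (q - 1)) ^ q * ∫ ω, s n ω ^ q ∂P := by
  have h0 : ∀ n ω, 0 ≤ partialSups (fun i => s i ω) n := fun n ω =>
    (hs0 n ω).trans (le_partialSups (fun i => s i ω) n)
  have hI := integrable_rpow_partialSups hs hs0 hi
  have hJ : ∀ i, Integrable
      (fun ω => partialSups (fun i => s i ω) i ^ (q - 1) * (s (i + 1) ω - s i ω)) P := by
    intro i
    simp_rw [mul_sub]
    exact (integrable_rpow_sub_one_mul hq (measurable_partialSups hs i) (hs (i + 1)) (h0 i)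
      (hs0 (i + 1)) (hI i) (hi (i + 1))).sub
      (integrable_rpow_sub_one_mul hq (measurable_partialSups hs i) (hs i) (h0 i)
      (hs0 i) (hI i) (hi i))
  have hS := integrable_finsetSum (Finset.range n) fun i _ => hJ i
  have h := integral_mono ((hI n).add (hS.const_mul (q * (q / (q - 1)))))
    ((hi n).const_mul ((q / (q - 1)) ^ q)) fun ω => rpow_partialSups_le hq (fun n => hs0 n ω) n
  simp only [Pi.add_apply] at h
  rw [integral_add (hI n) (hS.const_mul _), integral_const_mul, integral_const_mul,
    integral_finsetSum _ fun i _ => hJ i] at h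
  have hq1 : 0 < q - 1 := by linarith
  have : 0 ≤ q * (q / (q - 1)) * ∑ i ∈ Finset.range n,
      ∫ ω, partialSups (fun i => s i ω) i ^ (q - 1) * (s (i + 1) ω - s i ω) ∂P :=
    mul_nonneg (by positivity) (Finset.sum_nonneg fun i _ => hsub i)
  linarith

end Doob

/-! ### Maximal products of consecutive independent factors. -/

section IndependentFactors

variable {Ω : Type*} {ξ : ℕ → Ω → ℝ} {q : ℝ}

/-- The `σ`-algebra generated by the first `n` variables. -/
abbrev past (ξ : ℕ → Ω → ℝ) (n : ℕ) : MeasurableSpace Ω :=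
  ⨆ i ∈ Set.Iio n, MeasurableSpace.comap (ξ i) inferInstance

theorem past_mono {m n : ℕ} (h : m ≤ n) : past ξ m ≤ past ξ n :=
  biSup_mono fun _ hi => lt_of_lt_of_le hi h

theorem measurable_past {i n : ℕ} (h : i < n) : Measurable[past ξ n] (ξ i) :=
  measurable_iff_comap_le.2 (le_iSup₂_of_le i h le_rfl)

theorem measurable_past_partialSups {s : ℕ → Ω → ℝ} (hs : ∀ n, Measurable[past ξ n] (s n)) (n : ℕ) :
    Measurable[past ξ n] fun ω => partialSups (fun i => s i ω) n := by
  induction n with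
  | zero => simpa using hs 0
  | succ n ih =>
    simp only [partialSups_add_one]
    exact (ih.mono (past_mono n.le_succ) le_rfl).sup (hs _)

theorem measurable_past_prod (n : ℕ) :
    Measurable[past ξ n] fun ω => ∏ i ∈ Finset.range n, ξ i ω :=
  Finset.measurable_fun_prod _ fun _ hi => measurable_past (Finset.mem_range.1 hi)

/-- The largest product of a final segment of the first `n` factors. -/
noncomputable def maxSuffixProd (x : ℕ → ℝ) : ℕ → ℝ
  | 0 => 1
  | n + 1 => max (maxSuffixProd x n * x n) 1

theorem one_le_maxSuffixProd (x : ℕ → ℝ) (n : ℕ) : 1 ≤ maxSuffixProd x n := by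
  cases n with
  | zero => exact le_rfl
  | succ n => exact le_max_right _ _

theorem prod_Ico_le_maxSuffixProd {x : ℕ → ℝ} (hx : ∀ n, 0 ≤ x n) {i j : ℕ} (hij : i ≤ j) :
    ∏ l ∈ Finset.Ico i j, x l ≤ maxSuffixProd x j := by
  induction j, hij using Nat.le_induction with
  | base => simpa using one_le_maxSuffixProd x i
  | succ j hij ih =>
    rw [Finset.prod_Ico_succ_top hij]
    exact (mul_le_mul_of_nonneg_right ih (hx j)).trans (le_max_left _ _)

/-- Each step of the recursion either extends the optimal segment by a factor or restarts from the
empty product. -/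
theorem exists_maxSuffixProd_eq (x : ℕ → ℝ) (n : ℕ) :
    ∃ i ≤ n, maxSuffixProd x n = ∏ l ∈ Finset.Ico i n, x l := by
  induction n with
  | zero => exact ⟨0, le_rfl, by simp [maxSuffixProd]⟩
  | succ n ih =>
    obtain ⟨i, hi, h⟩ := ih
    rcases max_cases (maxSuffixProd x n * x n) 1 with h1 | h1
    · exact ⟨i, by omega, by rw [maxSuffixProd, h1.1, h, Finset.prod_Ico_succ_top hi]⟩
    · exact ⟨n + 1, le_rfl, by rw [maxSuffixProd, h1.1]; simp⟩

/-- The permutation of `ℕ` that reverses `{0, …, N - 1}`. -/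
def reverseBelow (N j : ℕ) : ℕ := if j < N then N - 1 - j else j

theorem reverseBelow_injective (N : ℕ) : Function.Injective (reverseBelow N) := by
  intro a b h
  unfold reverseBelow at h
  grind

theorem prod_Ico_eq_prod_reverseBelow (x : ℕ → ℝ) {i N : ℕ} (hi : i ≤ N) :
    ∏ l ∈ Finset.Ico i N, x l = ∏ l ∈ Finset.range (N - i), x (reverseBelow N l) := by
  rw [Finset.prod_Ico_eq_prod_range, ← Finset.prod_range_reflect]
  refine Finset.prod_congr rfl fun l hl => ?_
  have := Finset.mem_range.1 hl
  rw [reverseBelow, if_pos (by omega)]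
  congr 1
  omega

theorem measurable_past_maxSuffixProd (n : ℕ) :
    Measurable[past ξ n] fun ω => maxSuffixProd (fun i => ξ i ω) n := by
  induction n with
  | zero => exact measurable_const
  | succ n ih =>
    exact ((ih.mono (past_mono n.le_succ) le_rfl).mul (measurable_past n.lt_succ_self)).max
      measurable_const

variable [mΩ : MeasurableSpace Ω] {P : Measure Ω}

theorem past_le (hm : ∀ n, Measurable (ξ n)) (n : ℕ) : past ξ n ≤ mΩ :=
  iSup₂_le fun i _ => (hm i).comap_le

theorem indepFun_of_measurable_past (hind : iIndepFun ξ P) (hm : ∀ n, Measurable (ξ n)) {n : ℕ}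
    {f : Ω → ℝ} (hf : Measurable[past ξ n] f) : IndepFun f (ξ n) P := by
  have h := indep_iSup_of_disjoint (fun i => (hm i).comap_le) hind
    (S := Set.Iio n) (T := {n}) (by simp)
  rw [iSup_singleton] at h
  exact indep_of_indep_of_le_left h (measurable_iff_comap_le.1 hf)

/-- Doob's `L^q` inequality for submartingales in the filtration of independent factors of
expectation one. -/
theorem integral_rpow_partialSups_le_of_mul_le (hq : 1 < q) (hind : iIndepFun ξ P)
    (hm : ∀ n, Measurable (ξ n)) (hξi : ∀ n, Integrable (ξ n) P) (hξ1 : ∀ n, ∫ ω, ξ n ω ∂P = 1)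
    {s : ℕ → Ω → ℝ} (hs : ∀ n, Measurable[past ξ n] (s n)) (hs0 : ∀ n ω, 0 ≤ s n ω)
    (hi : ∀ n, Integrable (fun ω => s n ω ^ q) P)
    (hmul : ∀ n ω, s n ω * ξ n ω ≤ s (n + 1) ω) (n : ℕ) :
    ∫ ω, partialSups (fun i => s i ω) n ^ q ∂P ≤ (q / (q - 1)) ^ q * ∫ ω, s n ω ^ q ∂P := by
  have := hind.isProbabilityMeasure
  have hs' : ∀ n, Measurable (s n) := fun n => (hs n).mono (past_le hm n) le_rfl
  have h0 : ∀ n ω, 0 ≤ partialSups (fun i => s i ω) n := fun n ω =>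
    (hs0 n ω).trans (le_partialSups (fun i => s i ω) n)
  have hI := integrable_rpow_partialSups hs' hs0 hi
  refine integral_rpow_partialSups_le hq hs' hs0 hi (fun n => ?_) n
  have hA := integrable_rpow_sub_one_mul hq (measurable_partialSups hs' n) (hs' (n + 1)) (h0 n)
      (hs0 (n + 1)) (hI n) (hi (n + 1))
  have hB := integrable_rpow_sub_one_mul hq (measurable_partialSups hs' n) (hs' n) (h0 n)
      (hs0 n) (hI n) (hi n)
  have hmeas : Measurable[past ξ n] fun ω => partialSups (fun i => s i ω) n ^ (q - 1) * s n ω :=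
    ((measurable_past_partialSups hs n).pow_const _).mul (hs n)
  have hindep : IndepFun (fun ω => partialSups (fun i => s i ω) n ^ (q - 1) * s n ω)
      (fun ω => ξ n ω - 1) P :=
    (indepFun_of_measurable_past hind hm hmeas).comp (φ := id) (ψ := fun x => x - 1)
      measurable_id (by fun_prop)
  have hC : Integrable (fun ω => ξ n ω - 1) P := (hξi n).sub (integrable_const 1)
  have hint : Integrable
      (fun ω => (partialSups (fun i => s i ω) n ^ (q - 1) * s n ω) * (ξ n ω - 1)) P :=
    hindep.integrable_mul hB hC
  -- The first factor depends on the past only, and `ξ n - 1` is independent of the past and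
  -- centred. By `hmul` this integrand lies below the one whose integral has to be nonnegative.
  have hzero : ∫ ω, (partialSups (fun i => s i ω) n ^ (q - 1) * s n ω) * (ξ n ω - 1) ∂P = 0 := by
    rw [hindep.integral_fun_mul_eq_mul_integral hB.aestronglyMeasurable hC.aestronglyMeasurable,
      integral_sub (hξi n) (integrable_const 1), hξ1]
    simp
  rw [← hzero]
  refine integral_mono hint ?_ fun ω => ?_
  · simp only [mul_sub]
    exact hA.sub hB
  have h1 := mul_le_mul_of_nonneg_left (hmul n ω) (Real.rpow_nonneg (h0 n ω) (q - 1))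
  simp only
  linarith

theorem integrable_rpow_mul (hind : iIndepFun ξ P) (hm : ∀ n, Measurable (ξ n))
    (hξ0 : ∀ n ω, 0 ≤ ξ n ω) (hξq : ∀ n, Integrable (fun ω => ξ n ω ^ q) P) {n : ℕ} {f : Ω → ℝ}
    (hf : Measurable[past ξ n] f) (hf0 : ∀ ω, 0 ≤ f ω) (hfi : Integrable (fun ω => f ω ^ q) P) :
    Integrable (fun ω => (f ω * ξ n ω) ^ q) P := by
  have h : IndepFun (fun ω => f ω ^ q) (fun ω => ξ n ω ^ q) P :=
    (indepFun_of_measurable_past hind hm hf).comp (φ := fun x => x ^ q) (ψ := fun x => x ^ q)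
      (by fun_prop) (by fun_prop)
  simp_rw [fun ω => Real.mul_rpow (z := q) (hf0 ω) (hξ0 n ω)]
  exact h.integrable_mul hfi (hξq n)

theorem integrable_rpow_prod (hind : iIndepFun ξ P) (hm : ∀ n, Measurable (ξ n))
    (hξ0 : ∀ n ω, 0 ≤ ξ n ω) (hξq : ∀ n, Integrable (fun ω => ξ n ω ^ q) P) (n : ℕ) :
    Integrable (fun ω => (∏ i ∈ Finset.range n, ξ i ω) ^ q) P := by
  have := hind.isProbabilityMeasure
  induction n with
  | zero => simp
  | succ n ih =>
    simp_rw [Finset.prod_range_succ]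
    exact integrable_rpow_mul hind hm hξ0 hξq (measurable_past_prod n)
      (fun ω => Finset.prod_nonneg fun i _ => hξ0 i ω) ih

theorem integral_rpow_partialSups_prod_le (hq : 1 < q) (hind : iIndepFun ξ P)
    (hm : ∀ n, Measurable (ξ n)) (hξ0 : ∀ n ω, 0 ≤ ξ n ω) (hξi : ∀ n, Integrable (ξ n) P)
    (hξ1 : ∀ n, ∫ ω, ξ n ω ∂P = 1) (hξq : ∀ n, Integrable (fun ω => ξ n ω ^ q) P) (n : ℕ) :
    ∫ ω, partialSups (fun j => ∏ i ∈ Finset.range j, ξ i ω) n ^ q ∂P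
      ≤ (q / (q - 1)) ^ q * ∫ ω, (∏ i ∈ Finset.range n, ξ i ω) ^ q ∂P :=
  integral_rpow_partialSups_le_of_mul_le hq hind hm hξi hξ1
    (s := fun j ω => ∏ i ∈ Finset.range j, ξ i ω) measurable_past_prod
    (fun _ ω => Finset.prod_nonneg fun i _ => hξ0 i ω)
    (integrable_rpow_prod hind hm hξ0 hξq)
    (fun _ _ => (Finset.prod_range_succ _ _).ge) n

/-- Reversing the first n factors preserves independence and the full product, and turns final
segments into initial ones, to which Doob's inequality applies. -/
theorem integral_rpow_maxSuffixProd_le (hq : 1 < q) (hind : iIndepFun ξ P)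
    (hm : ∀ n, Measurable (ξ n)) (hξ0 : ∀ n ω, 0 ≤ ξ n ω) (hξi : ∀ n, Integrable (ξ n) P)
    (hξ1 : ∀ n, ∫ ω, ξ n ω ∂P = 1) (hξq : ∀ n, Integrable (fun ω => ξ n ω ^ q) P) (n : ℕ) :
    ∫ ω, maxSuffixProd (fun i => ξ i ω) n ^ q ∂P
      ≤ (q / (q - 1)) ^ q * ∫ ω, (∏ i ∈ Finset.range n, ξ i ω) ^ q ∂P := by
  have h := integral_rpow_partialSups_prod_le (ξ := fun i => ξ (reverseBelow n i)) hq (hind.precomp (reverseBelow_injective n))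
    (fun _ => hm _) (fun _ => hξ0 _) (fun _ => hξi _) (fun _ => hξ1 _) (fun _ => hξq _) n
  have e : ∀ ω, ∏ i ∈ Finset.range n, ξ (reverseBelow n i) ω = ∏ i ∈ Finset.range n, ξ i ω := by
    intro ω
    have := prod_Ico_eq_prod_reverseBelow (fun i => ξ i ω) (Nat.zero_le n)
    rw [Nat.sub_zero, ← Finset.range_eq_Ico] at this
    exact this.symm
  simp_rw [e] at h
  refine le_trans (integral_mono_of_nonneg (ae_of_all _ fun ω => ?_) ?_ (ae_of_all _ fun ω => ?_)) h
  · exact Real.rpow_nonneg (zero_le_one.trans (one_le_maxSuffixProd _ _)) _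
  · exact integrable_rpow_partialSups
      (s := fun j ω => ∏ i ∈ Finset.range j, ξ (reverseBelow n i) ω)
      (fun j => Finset.measurable_fun_prod _ fun i _ => hm _)
      (fun j ω => Finset.prod_nonneg fun i _ => hξ0 _ ω)
      (integrable_rpow_prod (ξ := fun i => ξ (reverseBelow n i))
        (hind.precomp (reverseBelow_injective n)) (fun _ => hm _)
        (fun _ => hξ0 _) (fun _ => hξq _)) n
  · obtain ⟨i, hi, h⟩ := exists_maxSuffixProd_eq (fun i => ξ i ω) n
    have h0 := one_le_maxSuffixProd (fun i => ξ i ω) n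
    refine Real.rpow_le_rpow (by linarith) ?_ (by linarith)
    rw [h, prod_Ico_eq_prod_reverseBelow _ hi]
    exact le_partialSups_of_le (fun j => ∏ l ∈ Finset.range j, ξ (reverseBelow n l) ω)
      (Nat.sub_le n i)

theorem integrable_rpow_maxSuffixProd (hind : iIndepFun ξ P) (hm : ∀ n, Measurable (ξ n))
    (hξ0 : ∀ n ω, 0 ≤ ξ n ω) (hξq : ∀ n, Integrable (fun ω => ξ n ω ^ q) P) (n : ℕ) :
    Integrable (fun ω => maxSuffixProd (fun i => ξ i ω) n ^ q) P := by
  have := hind.isProbabilityMeasure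
  have h0 : ∀ n ω, 0 ≤ maxSuffixProd (fun i => ξ i ω) n := fun n ω =>
    zero_le_one.trans (one_le_maxSuffixProd _ _)
  induction n with
  | zero => simp [maxSuffixProd]
  | succ n ih =>
    have h1 := integrable_rpow_mul hind hm hξ0 hξq (measurable_past_maxSuffixProd n) (h0 n) ih
    refine (h1.add (integrable_const 1)).mono'
      (((measurable_past_maxSuffixProd (n + 1)).mono (past_le hm _) le_rfl).pow_const
        q).aestronglyMeasurable (ae_of_all _ fun ω => ?_)
    rw [Real.norm_of_nonneg (Real.rpow_nonneg (h0 _ _) _)]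
    simp only [maxSuffixProd, Pi.add_apply]
    have h2 := mul_nonneg (h0 n ω) (hξ0 n ω)
    rcases max_cases (maxSuffixProd (fun i => ξ i ω) n * ξ n ω) 1 with h3 | h3
    · rw [h3.1]; linarith
    · rw [h3.1, Real.one_rpow]; linarith [Real.rpow_nonneg h2 q]

/-- Doob's inequality is used once for the right end of the segment, by the submartingale property
of the maximal suffix product, and once for the left end, by reversal. -/
theorem integral_rpow_partialSups_maxSuffixProd_le (hq : 1 < q) (hind : iIndepFun ξ P)
    (hm : ∀ n, Measurable (ξ n)) (hξ0 : ∀ n ω, 0 ≤ ξ n ω) (hξi : ∀ n, Integrable (ξ n) P)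
    (hξ1 : ∀ n, ∫ ω, ξ n ω ∂P = 1) (hξq : ∀ n, Integrable (fun ω => ξ n ω ^ q) P) (n : ℕ) :
    ∫ ω, partialSups (maxSuffixProd fun i => ξ i ω) n ^ q ∂P
      ≤ (q / (q - 1)) ^ (2 * q) * ∫ ω, (∏ i ∈ Finset.range n, ξ i ω) ^ q ∂P := by
  have hc : 0 < q / (q - 1) := div_pos (by linarith) (by linarith)
  calc _ ≤ (q / (q - 1)) ^ q * ∫ ω, maxSuffixProd (fun i => ξ i ω) n ^ q ∂P :=
        integral_rpow_partialSups_le_of_mul_le hq hind hm hξi hξ1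
          (s := fun j ω => maxSuffixProd (fun i => ξ i ω) j) measurable_past_maxSuffixProd
          (fun _ ω => zero_le_one.trans (one_le_maxSuffixProd _ _))
          (integrable_rpow_maxSuffixProd hind hm hξ0 hξq)
          (fun _ _ => le_max_left _ _) n
    _ ≤ (q / (q - 1)) ^ q * ((q / (q - 1)) ^ q * ∫ ω, (∏ i ∈ Finset.range n, ξ i ω) ^ q ∂P) := by
        gcongr
        exact integral_rpow_maxSuffixProd_le hq hind hm hξ0 hξi hξ1 hξq n
    _ = _ := by rw [two_mul, Real.rpow_add hc]; ring

end IndependentFactors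

/-! ### Moments of a Lévy process and the supremum over a deterministic grid. -/

section LevyMoments

variable {Ω : Type*} {T : ℝ}

/-- The supremum of `exp(q (X_t - X_s))` over the pairs `s ≤ t` of a grid, from its `k`-th to its
`N`-th point. -/
noncomputable def gridSup (X : Time T → Ω → ℝ) (q : ℝ) (τ : ℕ → Time T) (k N : ℕ) (ω : Ω) : ℝ≥0∞ :=
  ⨆ (i : ℕ) (j : ℕ) (_ : k ≤ i) (_ : i ≤ j) (_ : j ≤ N),
    ENNReal.ofReal (Real.exp (q * (X (τ j) ω - X (τ i) ω)))

theorem gridSup_anti (X : Time T → Ω → ℝ) (q : ℝ) (τ : ℕ → Time T) {k l : ℕ} (h : k ≤ l) (N : ℕ)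
    (ω : Ω) : gridSup X q τ l N ω ≤ gridSup X q τ k N ω := by
  refine iSup_mono fun i => iSup_mono fun j => iSup_le fun hi => ?_
  exact le_iSup_of_le (h.trans hi) le_rfl

variable [MeasurableSpace Ω] {P : Measure Ω} {X : Time T → Ω → ℝ}

theorem IsLevyProcess.identDistrib_increment (hX : IsLevyProcess P X) {s t : Time T} (hst : s ≤ t) :
    ∃ u : Time T, (u : ℝ) = t - s ∧ IdentDistrib (fun ω => X t ω - X s ω) (X u) P P := by
  have hst' : (s : ℝ) ≤ t := hst
  let u : Time T := ⟨t - s, by linarith, by linarith [s.2.1, t.2.2]⟩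
  let z : Time T := ⟨0, le_rfl, s.2.1.trans s.2.2⟩
  refine ⟨u, rfl, (hX.stationary s t z u hst u.2.1 (by simp [u, z])).trans ?_⟩
  refine IdentDistrib.of_ae_eq ((hX.measurable u).sub (hX.measurable z)).aemeasurable ?_
  filter_upwards [hX.zero z rfl] with ω hω
  simp [hω]

variable [IsProbabilityMeasure P] {γ σ q : ℝ} {ν : Measure ℝ}

theorem HasCharacteristicTriplet.exp_moments (h : HasCharacteristicTriplet P X γ σ ν)
    (hm : ∀ t, Measurable (X t)) (hq : 1 < q)
    (hν : ∫⁻ x in {x : ℝ | 1 < |x|}, ENNReal.ofReal (Real.exp (q * x)) ∂ν < ∞) (t : Time T) :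
    Integrable (fun ω => Real.exp (q * X t ω)) P ∧
    ∫ ω, Real.exp (X t ω) ∂P = Real.exp (-(t : ℝ) * (charExponent γ σ ν (-Complex.I)).re) := by
  have hp : IsProbabilityMeasure (P.map (X t)) :=
    Measure.isProbabilityMeasure_map (hm t).aemeasurable
  obtain ⟨r, hr⟩ : ∃ r : ℝ≥0, (r : ℝ) = t := ⟨⟨t, t.2.1⟩, rfl⟩
  have key := exp_moments_of_charFun γ σ h.levyMeasure hq hν r (P.map (X t)) (fun u => by
    rw [levyCumulant_I_mul, charFun_apply_real, integral_map (hm t).aemeasurable (by fun_prop)]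
    have := h.charFun_eq t u
    simp only [mul_neg, neg_mul] at this ⊢
    rw [hr, ← this]
    refine integral_congr_ae (ae_of_all _ fun ω => ?_)
    simp only
    ring_nf)
  rw [integrable_map_measure (by fun_prop) (hm t).aemeasurable,
    integral_map (hm t).aemeasurable (by fun_prop)] at key
  refine ⟨key.1, ?_⟩
  -- The left side is a nonnegative real, so taking norms leaves only the real part of ψ(−i) and its
  -- imaginary part need not be examined.
  have h2 := congrArg norm key.2
  have h1 : levyCumulant γ σ ν 1 = -charExponent γ σ ν (-Complex.I) := by
    rw [← levyCumulant_I_mul]; simp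
  rw [Complex.norm_real, Real.norm_of_nonneg (integral_nonneg fun ω => by positivity),
    Complex.norm_exp, h1] at h2
  rw [h2, hr]
  simp

theorem integrable_exp_of_integrable_exp_mul {Y : Ω → ℝ} (hY : Measurable Y) (hq : 1 < q)
    (h : Integrable (fun ω => Real.exp (q * Y ω)) P) : Integrable (fun ω => Real.exp (Y ω)) P := by
  refine (h.add (integrable_const (1 : ℝ))).mono' (by fun_prop) (ae_of_all _ fun ω => ?_)
  rw [Real.norm_of_nonneg (Real.exp_nonneg _)]
  simp only [Pi.add_apply]
  rcases le_total 0 (Y ω) with h | h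
  · have : Real.exp (Y ω) ≤ Real.exp (q * Y ω) := Real.exp_le_exp.2 (by nlinarith)
    linarith
  · have := Real.exp_le_one_iff.2 h
    linarith [Real.exp_pos (q * Y ω)]

theorem IsLevyProcess.exp_moments_increment (hX : IsLevyProcess P X)
    (h : HasCharacteristicTriplet P X γ σ ν) (hq : 1 < q)
    (hν : ∫⁻ x in {x : ℝ | 1 < |x|}, ENNReal.ofReal (Real.exp (q * x)) ∂ν < ∞)
    {s t : Time T} (hst : s ≤ t) :
    Integrable (fun ω => Real.exp (q * (X t ω - X s ω))) P ∧
    ∫ ω, Real.exp (X t ω - X s ω) ∂P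
      = Real.exp (-((t : ℝ) - s) * (charExponent γ σ ν (-Complex.I)).re) := by
  obtain ⟨u, hu, hid⟩ := hX.identDistrib_increment hst
  obtain ⟨h1, h2⟩ := h.exp_moments hX.measurable hq hν u
  constructor
  · exact (hid.comp (u := fun x => Real.exp (q * x)) (by fun_prop)).integrable_iff.2 h1
  · rw [← hu, ← h2]
    exact (hid.comp (u := fun x => Real.exp x) (by fun_prop)).integral_eq

theorem lintegral_gridSup_le (hX : IsLevyProcess P X)
    (h : HasCharacteristicTriplet P X γ σ ν) (hq : 1 < q)
    (hν : ∫⁻ x in {x : ℝ | 1 < |x|}, ENNReal.ofReal (Real.exp (q * x)) ∂ν < ∞)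
    {τ : ℕ → Time T} (hτ : Monotone τ) (N : ℕ) (h0 : (τ 0 : ℝ) = 0) (hN : (τ N : ℝ) = T) :
    ∫⁻ ω, gridSup X q τ 0 N ω ∂P ≤
      ENNReal.ofReal (Real.exp (2 * q * T * ‖charExponent γ σ ν (-Complex.I)‖)
        * (q / (q - 1)) ^ (2 * q) * ∫ ω, Real.exp (q * X (τ N) ω) ∂P) := by
  set m := (charExponent γ σ ν (-Complex.I)).re with hm
  set M := ‖charExponent γ σ ν (-Complex.I)‖
  have hmM : |m| ≤ M := Complex.abs_re_le_norm _
  have hq0 : 0 < q := by linarith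
  have hT : 0 ≤ T := by rw [← hN]; exact (τ N).2.1
  have hc : 0 ≤ q / (q - 1) := div_nonneg hq0.le (by linarith)
  -- The drift `m` is the one that normalises each factor to mean one.
  let ξ : ℕ → Ω → ℝ := fun l ω =>
    Real.exp ((X (τ (l + 1)) ω - X (τ l) ω) + m * ((τ (l + 1) : ℝ) - τ l))
  have hξm : ∀ l, Measurable (ξ l) := fun l =>
    (((hX.measurable _).sub (hX.measurable _)).add_const _).exp
  have hξ0 : ∀ l ω, 0 ≤ ξ l ω := fun l ω => Real.exp_nonneg _
  have hmom := fun l => hX.exp_moments_increment h hq hν (hτ (Nat.le_succ l))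
  have hind : iIndepFun ξ P := (hX.indep.nat hτ).comp
    (fun l x => Real.exp (x + m * ((τ (l + 1) : ℝ) - τ l))) fun l => by fun_prop
  have hξi : ∀ l, Integrable (ξ l) P := by
    intro l
    simp only [ξ, Real.exp_add]
    exact (integrable_exp_of_integrable_exp_mul ((hX.measurable _).sub (hX.measurable _)) hq
      (hmom l).1).mul_const _
  have hξ1 : ∀ l, ∫ ω, ξ l ω ∂P = 1 := by
    intro l
    simp only [ξ, Real.exp_add]
    rw [integral_mul_const, (hmom l).2, ← Real.exp_add, Real.exp_eq_one_iff]
    simp only [← hm, Nat.succ_eq_add_one]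
    ring
  have hξq : ∀ l, Integrable (fun ω => ξ l ω ^ q) P := by
    intro l
    have e : ∀ ω, ξ l ω ^ q = Real.exp (q * (X (τ (l + 1)) ω - X (τ l) ω))
        * Real.exp (q * (m * ((τ (l + 1) : ℝ) - τ l))) := by
      intro ω
      rw [← Real.exp_add, ← Real.exp_mul]
      ring_nf
    simp_rw [e]
    exact (hmom l).1.mul_const _
  have hprod : ∀ ω {i j : ℕ}, i ≤ j → ∏ l ∈ Finset.Ico i j, ξ l ω
      = Real.exp ((X (τ j) ω - X (τ i) ω) + m * ((τ j : ℝ) - τ i)) := by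
    intro ω i j hij
    rw [← Real.exp_sum, Finset.sum_add_distrib, ← Finset.mul_sum,
      Finset.sum_Ico_sub (fun l => X (τ l) ω) hij, Finset.sum_Ico_sub (fun l => (τ l : ℝ)) hij]
  have hdiff : ∀ i j, i ≤ j → |m * ((τ j : ℝ) - τ i)| ≤ T * M := by
    intro i j hij
    have h1 : (τ i : ℝ) ≤ τ j := hτ hij
    rw [abs_mul, abs_of_nonneg (sub_nonneg.2 h1), mul_comm]
    exact mul_le_mul (by linarith [(τ i).2.1, (τ j).2.2]) hmM (abs_nonneg _) hT
  -- First factor exp(qTM): discarding the drift between two grid points.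
  have hpt : ∀ ω, gridSup X q τ 0 N ω ≤ ENNReal.ofReal
      (Real.exp (q * (T * M)) * partialSups (maxSuffixProd fun l => ξ l ω) N ^ q) := by
    intro ω
    refine iSup_le fun i => iSup_le fun j => iSup_le fun _ => iSup_le fun hij => iSup_le fun hj => ?_
    refine ENNReal.ofReal_le_ofReal ?_
    have h1 : Real.exp ((X (τ j) ω - X (τ i) ω) + m * ((τ j : ℝ) - τ i))
        ≤ partialSups (maxSuffixProd fun l => ξ l ω) N := by
      rw [← hprod ω hij]
      exact (prod_Ico_le_maxSuffixProd (fun l => hξ0 l ω) hij).trans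
        (le_partialSups_of_le (maxSuffixProd fun l => ξ l ω) hj)
    calc Real.exp (q * (X (τ j) ω - X (τ i) ω))
        = Real.exp (q * -(m * ((τ j : ℝ) - τ i)))
          * Real.exp ((X (τ j) ω - X (τ i) ω) + m * ((τ j : ℝ) - τ i)) ^ q := by
          rw [← Real.exp_mul, ← Real.exp_add]; ring_nf
      _ ≤ _ := by
          gcongr
          exact (neg_le_abs _).trans (hdiff i j hij)
  have hRi := integrable_rpow_partialSups
    (fun n => (measurable_past_maxSuffixProd n).mono (past_le hξm n) le_rfl)
    (fun _ ω => zero_le_one.trans (one_le_maxSuffixProd _ _))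
    (integrable_rpow_maxSuffixProd hind hξm hξ0 hξq) N
  have hmain := integral_rpow_partialSups_maxSuffixProd_le hq hind hξm hξ0 hξi hξ1 hξq N
  -- Second factor exp(qTM): returning from the full product to X at time T, as X starts at 0 almost
  -- surely.
  have hfin : ∫ ω, (∏ i ∈ Finset.range N, ξ i ω) ^ q ∂P
      ≤ Real.exp (q * (T * M)) * ∫ ω, Real.exp (q * X (τ N) ω) ∂P := by
    rw [← integral_const_mul]
    refine integral_mono_ae ?_ ?_ ?_
    · exact integrable_rpow_prod hind hξm hξ0 hξq N
    · exact (h.exp_moments hX.measurable hq hν (τ N)).1.const_mul _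
    · filter_upwards [hX.zero (τ 0) h0] with ω hω
      rw [Finset.range_eq_Ico, hprod ω (Nat.zero_le N), hω, ← Real.exp_mul, ← Real.exp_add]
      refine Real.exp_le_exp.2 ?_
      have := mul_le_mul_of_nonneg_left ((le_abs_self _).trans (hdiff 0 N (Nat.zero_le N))) hq0.le
      linarith
  have hPS : ∀ ω, 0 ≤ partialSups (maxSuffixProd fun l => ξ l ω) N := fun ω =>
    zero_le_one.trans ((one_le_maxSuffixProd _ _).trans (le_partialSups _ N))
  calc ∫⁻ ω, gridSup X q τ 0 N ω ∂P
      ≤ ∫⁻ ω, ENNReal.ofReal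
        (Real.exp (q * (T * M)) * partialSups (maxSuffixProd fun l => ξ l ω) N ^ q) ∂P :=
        lintegral_mono hpt
    _ = ENNReal.ofReal (Real.exp (q * (T * M))
          * ∫ ω, partialSups (maxSuffixProd fun l => ξ l ω) N ^ q ∂P) := by
        rw [← ofReal_integral_eq_lintegral_ofReal (hRi.const_mul _)
          (ae_of_all _ fun ω => mul_nonneg (Real.exp_nonneg _) (Real.rpow_nonneg (hPS ω) _)),
          integral_const_mul]
    _ ≤ _ := by
        refine ENNReal.ofReal_le_ofReal ?_
        have e : Real.exp (2 * q * T * M) = Real.exp (q * (T * M)) * Real.exp (q * (T * M)) := by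
          rw [← Real.exp_add]; ring_nf
        have h1 : 0 ≤ (q / (q - 1)) ^ (2 * q) := Real.rpow_nonneg hc _
        calc _ ≤ Real.exp (q * (T * M)) * ((q / (q - 1)) ^ (2 * q) *
              (Real.exp (q * (T * M)) * ∫ ω, Real.exp (q * X (τ N) ω) ∂P)) := by
              gcongr
              exact hmain.trans (mul_le_mul_of_nonneg_left hfin h1)
          _ = _ := by rw [e]; ring

end LevyMoments

/-! ### Rounding times up to a grid, and progressive measurability. -/

section Grid

variable {T : ℝ}

/-- The `j`-th point of the grid of mesh `T / (n + 1)` in `[0, T]`. -/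
noncomputable def gridTime (hT : 0 < T) (n j : ℕ) : Time T :=
  Set.projIcc 0 T hT.le (j * T / (n + 1))

/-- The index of the first grid point that is not before `u`. -/
noncomputable def gridIndex (n : ℕ) (u : Time T) : ℕ := ⌈(u : ℝ) * (n + 1) / T⌉₊

theorem gridTime_mono (hT : 0 < T) (n : ℕ) : Monotone (gridTime hT n) := fun i j hij =>
  Set.monotone_projIcc hT.le (by gcongr)

theorem coe_gridTime (hT : 0 < T) {n j : ℕ} (hj : j ≤ n + 1) :
    (gridTime hT n j : ℝ) = j * T / (n + 1) := by
  have hj' : (j : ℝ) ≤ n + 1 := by exact_mod_cast hj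
  rw [gridTime, Set.coe_projIcc, min_eq_right, max_eq_right (by positivity)]
  rw [div_le_iff₀ (by positivity), mul_comm]
  gcongr

theorem gridIndex_le (hT : 0 < T) (n : ℕ) (u : Time T) : gridIndex n u ≤ n + 1 := by
  rw [gridIndex, Nat.ceil_le, div_le_iff₀ hT, mul_comm]
  push_cast
  gcongr
  exact u.2.2

/-- This makes the rounding of a stopping time a stopping time again. Indices beyond `n + 1` are
excluded because the projection sends them all to T. -/
theorem le_gridTime_iff (hT : 0 < T) {n j : ℕ} (hj : j ≤ n + 1) (u : Time T) :
    u ≤ gridTime hT n j ↔ gridIndex n u ≤ j := by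
  rw [← Subtype.coe_le_coe, coe_gridTime hT hj, gridIndex, Nat.ceil_le, div_le_iff₀ hT,
    le_div_iff₀ (by positivity)]

theorem gridIndex_mono (hT : 0 < T) (n : ℕ) : Monotone (gridIndex (T := T) n) := fun u v huv => by
  refine Nat.ceil_mono ?_
  have : (u : ℝ) ≤ v := huv
  gcongr

theorem le_gridTime_gridIndex (hT : 0 < T) (n : ℕ) (u : Time T) :
    u ≤ gridTime hT n (gridIndex n u) :=
  (le_gridTime_iff hT (gridIndex_le hT n u) u).2 le_rfl

theorem gridTime_gridIndex_le (hT : 0 < T) (n : ℕ) (u : Time T) :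
    (gridTime hT n (gridIndex n u) : ℝ) ≤ u + T / (n + 1) := by
  have h0 : 0 ≤ (u : ℝ) * (n + 1) / T :=
    div_nonneg (mul_nonneg u.2.1 (by positivity)) hT.le
  have h := (Nat.ceil_lt_add_one h0).le
  rw [coe_gridTime hT (gridIndex_le hT n u), gridIndex]
  calc _ ≤ ((u : ℝ) * (n + 1) / T + 1) * T / (n + 1) := by gcongr
    _ = _ := by field_simp

theorem tendsto_gridTime_gridIndex (hT : 0 < T) (u : Time T) :
    Tendsto (fun n => gridTime hT n (gridIndex n u)) atTop (𝓝[Set.Ici u] u) := by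
  refine tendsto_nhdsWithin_iff.2 ⟨?_, Eventually.of_forall fun n => le_gridTime_gridIndex hT n u⟩
  rw [tendsto_subtype_rng]
  have h1 : Tendsto (fun n : ℕ => (u : ℝ) + T / ((n : ℝ) + 1)) atTop (𝓝 (u + 0)) := by
    refine Tendsto.const_add _ ?_
    have := (tendsto_one_div_add_atTop_nhds_zero_nat (𝕜 := ℝ)).const_mul T
    simpa [div_eq_mul_inv] using this
  rw [add_zero] at h1
  exact tendsto_of_tendsto_of_tendsto_of_le_of_le tendsto_const_nhds h1
    (fun n => le_gridTime_gridIndex hT n u) (fun n => gridTime_gridIndex_le hT n u)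

theorem measurable_gridIndex (n : ℕ) : Measurable (gridIndex (T := T) n) := by
  unfold gridIndex
  exact Nat.measurable_ceil.comp (by fun_prop)

/-- Rounding up to the grid and capping at i approximates each time from the right without leaving
`Set.Iic i`. Each approximation factors through ℕ × Ω. -/
theorem measurable_uncurry_of_rightContinuous {Ω : Type*} [MeasurableSpace Ω] (hT : 0 < T)
    (i : Time T) {Φ : Time T → Ω → ℝ} (hΦ : ∀ s ≤ i, Measurable (Φ s))
    (hc : ∀ ω t, ContinuousWithinAt (fun t => Φ t ω) (Set.Ici t) t) :
    Measurable fun p : Set.Iic i × Ω => Φ p.1 p.2 := by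
  have hk : ∀ n, Measurable fun p : Set.Iic i × Ω => (gridIndex n (p.1 : Time T), p.2) := fun n =>
    ((measurable_gridIndex n).comp (measurable_subtype_coe.comp measurable_fst)).prodMk
      measurable_snd
  have hg : ∀ n, Measurable fun p : ℕ × Ω => Φ (min (gridTime hT n p.1) i) p.2 := fun n =>
    measurable_from_prod_countable_right fun k => hΦ (min (gridTime hT n k) i) (min_le_right _ _)
  refine measurable_of_tendsto_metrizable (fun n => (hg n).comp (hk n)) ?_
  rw [tendsto_pi_nhds]
  rintro ⟨⟨s, hs⟩, ω⟩
  refine (hc ω s).tendsto.comp (tendsto_nhdsWithin_iff.2 ⟨?_, Eventually.of_forall fun n => ?_⟩)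
  · have h2 := (tendsto_nhdsWithin_iff.1 (tendsto_gridTime_gridIndex hT s)).1.min
      (tendsto_const_nhds (x := i))
    rwa [min_eq_left (show s ≤ i from hs)] at h2
  · exact le_min (le_gridTime_gridIndex hT n s) hs

variable {Ω : Type*} [mΩ : MeasurableSpace Ω]

/-- A right-continuous adapted process is progressively measurable. -/
theorem isStronglyProgressive_of_rightContinuous (hT : 0 < T) {𝓕 : Filtration (Time T) mΩ}
    {Φ : Time T → Ω → ℝ} (hΦ : Adapted 𝓕 Φ)
    (hc : ∀ ω t, ContinuousWithinAt (fun t => Φ t ω) (Set.Ici t) t) :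
    IsStronglyProgressive 𝓕 Φ := fun i =>
  (@measurable_uncurry_of_rightContinuous T Ω (𝓕 i) hT i Φ
    (fun s hs => (hΦ s).mono (𝓕.mono hs) le_rfl) hc).stronglyMeasurable

theorem measurable_comp_stoppingTime (hT : 0 < T) {𝓕 : Filtration (Time T) mΩ}
    {Φ : Time T → Ω → ℝ} (hΦ : Adapted 𝓕 Φ)
    (hc : ∀ ω t, ContinuousWithinAt (fun t => Φ t ω) (Set.Ici t) t) {ρ : Ω → Time T}
    (hρ : IsStoppingTime 𝓕 fun ω => (ρ ω : WithTop (Time T))) :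
    Measurable[hρ.measurableSpace] fun ω => Φ (ρ ω) ω := by
  have : Nonempty (Time T) := ⟨⟨0, le_rfl, hT.le⟩⟩
  exact measurable_stoppedValue (isStronglyProgressive_of_rightContinuous hT hΦ hc) hρ

end Grid

/-! ### Running suprema of càdlàg paths. -/

section RunningSup

variable {T : ℝ}

theorem IsCadlagPath.comp_continuous {f : Time T → ℝ} (hf : IsCadlagPath f) {g : ℝ → ℝ}
    (hg : Continuous g) : IsCadlagPath fun t => g (f t) := fun t => by
  obtain ⟨h1, l, h2⟩ := hf t
  exact ⟨hg.continuousAt.comp_continuousWithinAt h1, g l, (hg.tendsto l).comp h2⟩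

theorem IsCadlagPath.mul {f g : Time T → ℝ} (hf : IsCadlagPath f) (hg : IsCadlagPath g) :
    IsCadlagPath fun t => f t * g t := fun t => by
  obtain ⟨h1, l, h2⟩ := hf t
  obtain ⟨h3, l', h4⟩ := hg t
  exact ⟨h1.mul h3, l * l', h2.mul h4⟩

theorem IsCadlagPath.isBoundedUnder {f : Time T → ℝ} (hf : IsCadlagPath f) (t : Time T) :
    ∃ C, ∀ᶠ s in 𝓝 t, |f s| ≤ C := by
  obtain ⟨h1, l, h2⟩ := hf t
  have h3 := h2.abs.eventually (ge_mem_nhds (show |l| < |l| + 1 by linarith))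
  have h4 := h1.tendsto.abs.eventually (ge_mem_nhds (show |f t| < |f t| + 1 by linarith))
  refine ⟨max (|l| + 1) (|f t| + 1), ?_⟩
  rw [← nhdsLT_sup_nhdsGE, eventually_sup]
  exact ⟨h3.mono fun s hs => le_max_of_le_left hs, h4.mono fun s hs => le_max_of_le_right hs⟩

theorem IsCadlagPath.exists_abs_le {f : Time T → ℝ} (hf : IsCadlagPath f) :
    ∃ C, ∀ t, |f t| ≤ C := by
  have key : ∃ C, ∀ t ∈ (Set.univ : Set (Time T)), |f t| ≤ C := by
    refine isCompact_univ.induction_on (p := fun s => ∃ C, ∀ t ∈ s, |f t| ≤ C)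
      ⟨0, by simp⟩ ?_ ?_ ?_
    · rintro s t hst ⟨C, hC⟩
      exact ⟨C, fun x hx => hC x (hst hx)⟩
    · rintro s t ⟨C, hC⟩ ⟨D, hD⟩
      refine ⟨max C D, fun x hx => ?_⟩
      rcases hx with hx | hx
      · exact le_max_of_le_left (hC x hx)
      · exact le_max_of_le_right (hD x hx)
    · intro t _
      obtain ⟨C, hC⟩ := hf.isBoundedUnder t
      exact ⟨{s | |f s| ≤ C}, mem_nhdsWithin_of_mem_nhds hC, C, fun s hs => hs⟩
  obtain ⟨C, hC⟩ := key
  exact ⟨C, fun t => hC t trivial⟩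

theorem IsCadlagPath.bddAbove {f : Time T → ℝ} (hf : IsCadlagPath f) (t : Time T) :
    BddAbove (Set.range fun u : Set.Iic t => f u) := by
  obtain ⟨C, hC⟩ := hf.exists_abs_le
  exact ⟨C, by rintro _ ⟨u, rfl⟩; exact (le_abs_self _).trans (hC _)⟩

theorem IsCadlagPath.runningSup_mono {f : Time T → ℝ} (hf : IsCadlagPath f) :
    Monotone fun t : Time T => ⨆ u : Set.Iic t, f u := fun s t hst => by
  have : Nonempty (Set.Iic s) := ⟨⟨s, Set.self_mem_Iic⟩⟩
  exact ciSup_le fun u => le_ciSup (hf.bddAbove t) ⟨u, le_trans u.2 hst⟩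

/-- Just after t the path stays below f t + ε/2, so the supremum rises by at most ε/2. Left limits
come from monotonicity. -/
theorem IsCadlagPath.runningSup {f : Time T → ℝ} (hf : IsCadlagPath f) :
    IsCadlagPath fun t : Time T => ⨆ u : Set.Iic t, f u := fun t => by
  have hmono := hf.runningSup_mono
  have hle : ∀ {s u : Time T}, u ≤ s → f u ≤ ⨆ u : Set.Iic s, f u := fun {s u} h =>
    le_ciSup (hf.bddAbove s) ⟨u, h⟩
  constructor
  · rw [ContinuousWithinAt, Metric.tendsto_nhds]
    intro ε hε
    have h1 := (hf t).1.tendsto.eventually (gt_mem_nhds (show f t < f t + ε / 2 by linarith))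
    rw [eventually_nhdsWithin_iff] at h1
    obtain ⟨δ, hδ, h2⟩ := Metric.eventually_nhds_iff.1 h1
    filter_upwards [self_mem_nhdsWithin, mem_nhdsWithin_of_mem_nhds (Metric.ball_mem_nhds t hδ)]
      with s hs hsδ
    have hts : t ≤ s := hs
    have hle' : (⨆ u : Set.Iic s, f u) ≤ (⨆ u : Set.Iic t, f u) + ε / 2 := by
      have : Nonempty (Set.Iic s) := ⟨⟨s, Set.self_mem_Iic⟩⟩
      refine ciSup_le fun u => ?_
      rcases le_total (u : Time T) t with h | h
      · linarith [hle h]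
      · have hu : dist (u : Time T) t < δ := by
          refine lt_of_le_of_lt ?_ hsδ
          rw [Subtype.dist_eq, Subtype.dist_eq, Real.dist_eq, Real.dist_eq]
          have h3 : (t : ℝ) ≤ (u : Time T) := h
          have h4 : ((u : Time T) : ℝ) ≤ s := u.2
          rw [abs_of_nonneg (by linarith), abs_of_nonneg (by linarith)]
          linarith
        linarith [h2 hu h, hle (le_refl t)]
    rw [Real.dist_eq, abs_of_nonneg (sub_nonneg.2 (hmono hts))]
    linarith
  · exact ⟨_, hmono.tendsto_nhdsLT t⟩

/-- A countable supremum, needed for adaptedness. The cap at t keeps t itself and never uses later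
times. -/
theorem runningSup_eq_iSup_grid (hT : 0 < T) {f : Time T → ℝ} (hf : IsCadlagPath f) (t : Time T) :
    (⨆ u : Set.Iic t, f u) = ⨆ p : ℕ × ℕ, f (min (gridTime hT p.1 p.2) t) := by
  have : Nonempty (Set.Iic t) := ⟨⟨t, Set.self_mem_Iic⟩⟩
  have hb : BddAbove (Set.range fun p : ℕ × ℕ => f (min (gridTime hT p.1 p.2) t)) := by
    obtain ⟨C, hC⟩ := hf.exists_abs_le
    exact ⟨C, by rintro _ ⟨p, rfl⟩; exact (le_abs_self _).trans (hC _)⟩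
  refine le_antisymm (ciSup_le fun u => ?_) (ciSup_le fun p =>
    le_ciSup (hf.bddAbove t) ⟨min (gridTime hT p.1 p.2) t, Set.mem_Iic.2 (min_le_right _ _)⟩)
  have h1 : Tendsto (fun n => min (gridTime hT n (gridIndex n (u : Time T))) t) atTop
      (𝓝[Set.Ici (u : Time T)] u) := by
    refine tendsto_nhdsWithin_iff.2 ⟨?_, Eventually.of_forall fun n => ?_⟩
    · have h2 := (tendsto_nhdsWithin_iff.1 (tendsto_gridTime_gridIndex hT (u : Time T))).1.min
        (tendsto_const_nhds (x := t))
      rwa [min_eq_left (show (u : Time T) ≤ t from u.2)] at h2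
    · exact le_min (le_gridTime_gridIndex hT n _) u.2
  exact le_of_tendsto ((hf u).1.tendsto.comp h1) (Eventually.of_forall fun n =>
    le_ciSup hb (n, gridIndex n (u : Time T)))

end RunningSup

/-! ### The weight process: regularity and growth. -/

section Weight

variable {T : ℝ} {Ω : Type*} {X : Time T → Ω → ℝ}

theorem isCadlagPath_rpow_price (hX : ∀ ω, IsCadlagPath fun t => X t ω) (a : ℝ) (ω : Ω) :
    IsCadlagPath fun t => price X t ω ^ a := by
  have := (hX ω).comp_continuous (g := fun x => Real.exp (x * a)) (by fun_prop)
  simpa only [price, Real.exp_mul] using this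

theorem isCadlagPath_weight (hX : ∀ ω, IsCadlagPath fun t => X t ω) (η : ℝ) (ω : Ω) :
    IsCadlagPath fun t => weight (price X) η t ω :=
  ((hX ω).comp_continuous Real.continuous_exp).mul (isCadlagPath_rpow_price hX (η - 1) ω).runningSup

theorem weight_nonneg (η : ℝ) (t : Time T) (ω : Ω) : 0 ≤ weight (price X) η t ω :=
  mul_nonneg (Real.exp_nonneg _) (Real.iSup_nonneg fun _ => Real.rpow_nonneg (Real.exp_nonneg _) _)

/-- After time `s` the weight process grows at most by the largest quotient of prices. -/
theorem weight_le (hX : ∀ ω, IsCadlagPath fun t => X t ω) {η : ℝ} (hη : η ∈ Set.Icc (0 : ℝ) 1)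
    {s t : Time T} (hst : s ≤ t) (ω : Ω) {C : ℝ}
    (hC : ∀ u, s ≤ u → u ≤ t → Real.exp (X t ω - X u ω) ≤ C) :
    weight (price X) η t ω ≤ weight (price X) η s ω * C := by
  have hb := (isCadlagPath_rpow_price hX (η - 1) ω).bddAbove s
  set A := ⨆ u : Set.Iic s, price X u ω ^ (η - 1) with hA
  have hAs : price X s ω ^ (η - 1) ≤ A := le_ciSup hb ⟨s, Set.self_mem_Iic⟩
  have hS : 0 < price X s ω := Real.exp_pos _
  have hSt : 0 < price X t ω := Real.exp_pos _
  have hA0 : 0 < A := lt_of_lt_of_le (Real.rpow_pos_of_pos hS _) hAs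
  have : Nonempty (Set.Iic t) := ⟨⟨t, Set.self_mem_Iic⟩⟩
  have hw : weight (price X) η s ω = price X s ω * A := rfl
  rw [hw, weight, mul_comm, ← le_div_iff₀ hSt]
  refine ciSup_le fun u => ?_
  rw [le_div_iff₀ hSt]
  have hts : price X t ω = price X s ω * Real.exp (X t ω - X s ω) := by
    simp only [price]
    rw [← Real.exp_add]
    ring_nf
  have hC0 : 0 < C := (Real.exp_pos _).trans_le (hC s le_rfl hst)
  -- If the supremum is tested at u ≤ s, only S_t/S_s matters. If u ≥ s, S_u^(η−1) is not seen at
  -- time s and must be compared with S_s^(η−1).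
  rcases le_total (u : Time T) s with h | h
  · have h1 : price X u ω ^ (η - 1) ≤ A := le_ciSup hb ⟨u, h⟩
    rw [hts]
    calc _ ≤ A * (price X s ω * C) := by
          gcongr
          exact hC s le_rfl hst
      _ = _ := by ring
  · have h1 : price X s ω ^ η ≤ price X s ω * A := by
      calc price X s ω ^ η = price X s ω * price X s ω ^ (η - 1) := by
            have := Real.rpow_add hS 1 (η - 1)
            rwa [Real.rpow_one, add_sub_cancel] at this
        _ ≤ _ := by gcongr
    have h2 : price X u ω ^ (η - 1) * price X t ω ≤ price X s ω ^ η * C := by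
      have h3 := hC s le_rfl hst
      have h4 := hC u h u.2
      -- A geometric mean of S_t/S_s and S_t/S_u with exponents η and 1 − η; both quotients are at
      -- most C, hence so is the mean.
      have e : price X u ω ^ (η - 1) * price X t ω = price X s ω ^ η
          * (Real.exp (X t ω - X s ω) ^ η * Real.exp (X t ω - X u ω) ^ (1 - η)) := by
        simp only [price, ← Real.exp_mul, ← Real.exp_add]
        ring_nf
      rw [e]
      gcongr
      calc _ ≤ C ^ η * C ^ (1 - η) := by
            gcongr
            · exact hη.1
            · linarith [hη.2]
        _ = C := by rw [← Real.rpow_add hC0]; simp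
    calc _ ≤ price X s ω ^ η * C := h2
      _ ≤ _ := by gcongr

variable [mΩ : MeasurableSpace Ω] {P : Measure Ω}

theorem adapted_weight (hT : 0 < T) {𝓕 : Filtration (Time T) mΩ} (hX : ∀ ω, IsCadlagPath fun t => X t ω)
    (ha : Adapted 𝓕 X) (η : ℝ) : Adapted 𝓕 (weight (price X) η) := by
  intro t
  have hp : ∀ s ≤ t, Measurable[𝓕 t] (price X s) := fun s hs =>
    Real.measurable_exp.comp ((ha s).mono (𝓕.mono hs) le_rfl)
  have e : weight (price X) η t = fun ω =>
      price X t ω * ⨆ p : ℕ × ℕ, price X (min (gridTime hT p.1 p.2) t) ω ^ (η - 1) := by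
    funext ω
    rw [weight, runningSup_eq_iSup_grid hT (isCadlagPath_rpow_price hX (η - 1) ω) t]
  rw [e]
  exact (hp t le_rfl).mul (Measurable.iSup fun p => (hp _ (min_le_right _ _)).pow_const _)

theorem adapted_augmentedFiltration [P.IsComplete] (hm : ∀ t, Measurable (X t)) :
    Adapted (augmentedFiltration P X hm) X := fun t =>
  measurable_iff_comap_le.2 <| le_trans
    (le_iSup₂ (f := fun s (_ : s ≤ t) => MeasurableSpace.comap (X s) inferInstance) t le_rfl)
    le_sup_left

theorem isCLPlus_weight [P.IsComplete] (hT : 0 < T) (hm : ∀ t, Measurable (X t))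
    (hX : ∀ ω, IsCadlagPath fun t => X t ω) (η : ℝ) :
    IsCLPlus P (augmentedFiltration P X hm) (weight (price X) η) where
  adapted := adapted_weight hT hX (adapted_augmentedFiltration hm) η
  cadlag := isCadlagPath_weight hX η
  nonneg := ae_of_all _ fun ω t => weight_nonneg η t ω

end Weight

/-! ### Independence of the augmented past from future increments. -/

section Independence

theorem indep_eventuallyMeasurableSpace {Ω : Type*} {m₁ m₂ _m : MeasurableSpace Ω} {P : Measure Ω}
    (h : Indep m₁ m₂ P) : Indep (eventuallyMeasurableSpace m₁ (ae P)) m₂ P := by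
  rw [Indep_iff] at h ⊢
  rintro A B ⟨A', hA', hAA'⟩ hB
  rw [measure_congr hAA', ← h A' B hA' hB]
  exact measure_congr (hAA'.inter (ae_eq_refl B))

variable {Ω : Type*} {T : ℝ} {X : Time T → Ω → ℝ}

/-- The `σ`-algebra generated by the increments of `X` along a sequence of times. -/
abbrev incrementAlgebra (X : Time T → Ω → ℝ) (u : ℕ → Time T) : MeasurableSpace Ω :=
  ⨆ j, MeasurableSpace.comap (fun ω => X (u (j + 1)) ω - X (u j) ω) inferInstance

theorem measurable_incrementAlgebra (u : ℕ → Time T) {i j : ℕ} (hij : i ≤ j) :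
    Measurable[incrementAlgebra X u] fun ω => X (u j) ω - X (u i) ω := by
  simp_rw [fun ω => (Finset.sum_Ico_sub (fun l => X (u l) ω) hij).symm]
  exact Finset.measurable_fun_sum _ fun l _ => measurable_iff_comap_le.2
    (le_iSup (fun j => MeasurableSpace.comap (fun ω => X (u (j + 1)) ω - X (u j) ω) inferInstance) l)

variable [mΩ : MeasurableSpace Ω] {P : Measure Ω}

theorem incrementAlgebra_le (hm : ∀ t, Measurable (X t)) (u : ℕ → Time T) :
    incrementAlgebra X u ≤ mΩ :=
  iSup_le fun _ => ((hm _).sub (hm _)).comap_le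

/-- Independence of the increments between finitely many times up to `t` and those after `t`. -/
theorem indep_finset_increments (hm : ∀ t, Measurable (X t)) (hX : HasIndepIncrements X P)
    {u : ℕ → Time T} (hu : Monotone u) (J : Finset (Time T)) (hJ : ∀ s ∈ J, s ≤ u 0)
    {z : Time T} (hz : z ∈ J) :
    Indep (⨆ s ∈ J, MeasurableSpace.comap (fun ω => X s ω - X z ω) inferInstance)
      (incrementAlgebra X u) P := by
  -- The points of J in increasing order, followed by the sequence u.
  let τ : ℕ → Time T := fun i =>
    if h : i < J.card then J.orderEmbOfFin rfl ⟨i, h⟩ else u (i - J.card)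
  have hτ1 : ∀ {i} (h : i < J.card), τ i = J.orderEmbOfFin rfl ⟨i, h⟩ := fun h => dif_pos h
  have hτ2 : ∀ {i}, ¬ i < J.card → τ i = u (i - J.card) := fun h => dif_neg h
  have hτ : Monotone τ := by
    intro i j hij
    by_cases hi : i < J.card
    · by_cases hj : j < J.card
      · rw [hτ1 hi, hτ1 hj]
        exact (J.orderEmbOfFin rfl).monotone hij
      · rw [hτ1 hi, hτ2 hj]
        exact (hJ _ (J.orderEmbOfFin_mem rfl _)).trans (hu (Nat.zero_le _))
    · rw [hτ2 hi, hτ2 (by omega)]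
      exact hu (by omega)
  let ξ : ℕ → Ω → ℝ := fun i ω => X (τ (i + 1)) ω - X (τ i) ω
  have hξm : ∀ i, Measurable (ξ i) := fun i => (hm _).sub (hm _)
  have hind : iIndepFun ξ P := hX.nat hτ
  -- The increment with index `J.card - 1`, from the last point of J to `u 0`, is counted to the
  -- past; those from `J.card` on are exactly the increments of u.
  have h := indep_iSup_of_disjoint (fun i => (hξm i).comap_le) hind
    (S := Set.Iio J.card) (T := Set.Ici J.card) (Set.disjoint_left.2 fun i hi hi' =>
      absurd (Set.mem_Iio.1 hi) (not_lt.2 hi'))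
  have hpast : ∀ s ∈ J, ∃ k, k < J.card ∧ τ k = s := by
    intro s hs
    have : s ∈ Set.range (J.orderEmbOfFin rfl) := by rw [Finset.range_orderEmbOfFin]; exact hs
    obtain ⟨⟨k, hk⟩, rfl⟩ := this
    exact ⟨k, hk, hτ1 hk⟩
  have hmeas : ∀ k, k < J.card → Measurable[past ξ J.card] fun ω => X (τ k) ω - X (τ 0) ω := by
    intro k hk
    simp_rw [fun ω => (Finset.sum_range_sub (fun l => X (τ l) ω) k).symm]
    exact Finset.measurable_fun_sum _ fun l hl =>
      measurable_past (ξ := ξ) (lt_trans (Finset.mem_range.1 hl) hk)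
  refine indep_of_indep_of_le_left (indep_of_indep_of_le_right h ?_) ?_
  · refine iSup_le fun j => ?_
    refine le_trans (le_of_eq ?_) (le_iSup₂ (f := fun i (_ : i ∈ Set.Ici J.card) =>
      MeasurableSpace.comap (ξ i) inferInstance) (J.card + j) (Nat.le_add_right _ _))
    have h1 : τ (J.card + j + 1) = u (j + 1) := by rw [hτ2 (by omega)]; congr 1; omega
    have h2 : τ (J.card + j) = u j := by rw [hτ2 (by omega)]; congr 1; omega
    simp only [ξ, h1, h2]
  · refine iSup₂_le fun s hs => measurable_iff_comap_le.1 ?_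
    obtain ⟨k, hk, rfl⟩ := hpast s hs
    obtain ⟨l, hl, rfl⟩ := hpast z hz
    have e : (fun ω => X (τ k) ω - X (τ l) ω)
        = fun ω => (X (τ k) ω - X (τ 0) ω) - (X (τ l) ω - X (τ 0) ω) := by
      funext ω; ring
    rw [e]
    exact (hmeas k hk).sub (hmeas l hl)

/-- The past is a directed supremum over finite sets of times; z is added to each so that the
reference point is among them. -/
theorem indep_past_increments (hm : ∀ t, Measurable (X t)) (hX : HasIndepIncrements X P)
    {u : ℕ → Time T} (hu : Monotone u) {z : Time T} (hz : z ≤ u 0) :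
    Indep (⨆ s : Set.Iic (u 0), MeasurableSpace.comap (fun ω => X s ω - X z ω) inferInstance)
      (incrementAlgebra X u) P := by
  classical
  have := (hX.nat hu).isProbabilityMeasure
  rw [iSup_eq_iSup_finset]
  refine indep_iSup_of_directed_le (fun I => ?_)
    (fun I => iSup₂_le fun s _ => ((hm _).sub (hm _)).comap_le)
    (incrementAlgebra_le hm u)
    (Monotone.directed_le fun I I' h => biSup_mono fun s hs => Finset.mem_of_subset h hs)
  let J : Finset (Time T) := insert z (I.image Subtype.val)
  have hJ : ∀ s ∈ J, s ≤ u 0 := by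
    intro s hs
    rcases Finset.mem_insert.1 hs with rfl | hs
    · exact hz
    · obtain ⟨s, _, rfl⟩ := Finset.mem_image.1 hs
      exact s.2
  refine indep_of_indep_of_le_left (indep_finset_increments hm hX hu J hJ
    (Finset.mem_insert_self z _)) (iSup₂_le fun s hs => ?_)
  exact le_iSup₂ (f := fun (s : Time T) (_ : s ∈ J) =>
    MeasurableSpace.comap (fun ω => X s ω - X z ω) inferInstance) (s : Time T)
    (Finset.mem_insert_of_mem (Finset.mem_image_of_mem _ hs))

/-- Since X vanishes almost surely at time 0, values and increments from 0 generate the same events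
up to null sets. -/
theorem augmentedFiltration_le [P.IsComplete] (hX : IsLevyProcess P X) (t z : Time T)
    (hz : (z : ℝ) = 0) :
    augmentedFiltration P X hX.measurable t ≤ eventuallyMeasurableSpace
      (⨆ s : Set.Iic t, MeasurableSpace.comap (fun ω => X s ω - X z ω) inferInstance) (ae P) := by
  refine sup_le (iSup₂_le fun s hs => measurable_iff_comap_le.1 ?_)
    (MeasurableSpace.generateFrom_le fun A hA => ⟨∅, MeasurableSpace.measurableSet_empty _, ae_eq_empty.2 hA⟩)
  intro B hB
  refine ⟨(fun ω => X s ω - X z ω) ⁻¹' B, ?_, ?_⟩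
  · exact le_iSup (fun s : Set.Iic t =>
      MeasurableSpace.comap (fun ω => X s ω - X z ω) inferInstance) ⟨s, hs⟩ _ ⟨B, hB, rfl⟩
  · filter_upwards [hX.zero z hz] with ω hω
    change (X s ω ∈ B) = (X s ω - X z ω ∈ B)
    rw [hω, sub_zero]

theorem IsLevyProcess.indep_augmentedFiltration [P.IsComplete] (hX : IsLevyProcess P X)
    {u : ℕ → Time T} (hu : Monotone u) :
    Indep (augmentedFiltration P X hX.measurable (u 0)) (incrementAlgebra X u) P := by
  obtain ⟨z, hz⟩ : ∃ z : Time T, (z : ℝ) = 0 := ⟨⟨0, le_rfl, (u 0).2.1.trans (u 0).2.2⟩, rfl⟩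
  have hzu : z ≤ u 0 := by rw [← Subtype.coe_le_coe, hz]; exact (u 0).2.1
  have h1 := indep_eventuallyMeasurableSpace
    (indep_past_increments hX.measurable hX.indep hu hzu)
  exact indep_of_indep_of_le_left h1 (augmentedFiltration_le hX (u 0) z hz)

end Independence

/-! ### The conditional estimate at a stopping time. -/

section StoppingTimes

/-- The hypothesis says that on m the measure with density W is dominated by `B • P`; integrating
the m-measurable G against both gives the claim. -/
theorem lintegral_mul_le_of_setLIntegral_le {Ω : Type*} {m mΩ : MeasurableSpace Ω} {P : Measure Ω}
    (hm : m ≤ mΩ) {G W : Ω → ℝ≥0∞} (hG : Measurable[m] G) (hW : Measurable W) {B : ℝ≥0∞}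
    (h : ∀ A, MeasurableSet[m] A → ∫⁻ ω in A, W ω ∂P ≤ B * P A) :
    ∫⁻ ω, G ω * W ω ∂P ≤ B * ∫⁻ ω, G ω ∂P := by
  have hle : (P.withDensity W).trim hm ≤ B • P.trim hm := by
    refine Measure.le_iff.2 fun A hA => ?_
    rw [trim_measurableSet_eq hm hA, withDensity_apply _ (hm A hA), Measure.smul_apply,
      trim_measurableSet_eq hm hA]
    exact h A hA
  have hG' : Measurable G := hG.mono hm le_rfl
  calc ∫⁻ ω, G ω * W ω ∂P = ∫⁻ ω, G ω ∂(P.withDensity W) := by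
        rw [lintegral_withDensity_eq_lintegral_mul _ hW hG']
        simp [mul_comm]
    _ = ∫⁻ ω, G ω ∂((P.withDensity W).trim hm) := (lintegral_trim hm hG).symm
    _ ≤ ∫⁻ ω, G ω ∂(B • P.trim hm) := lintegral_mono' hle le_rfl
    _ = B * ∫⁻ ω, G ω ∂P := by rw [lintegral_smul_measure, lintegral_trim hm hG, smul_eq_mul]

theorem condLExp_le_of_setLIntegral_le {Ω : Type*} {m mΩ : MeasurableSpace Ω} {P : Measure Ω}
    [IsFiniteMeasure P] (hm : m ≤ mΩ) {Z Y : Ω → ℝ≥0∞} (hY : Measurable[m] Y)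
    (h : ∀ A, MeasurableSet[m] A → ∫⁻ ω in A, Z ω ∂P ≤ ∫⁻ ω in A, Y ω ∂P) :
    condLExp m P Z ≤ᵐ[P] Y := by
  refine ae_le_of_ae_le_trim (hm := hm) ?_
  refine ae_le_of_forall_setLIntegral_le_of_sigmaFinite (μ := P.trim hm)
    (measurable_condLExp m P Z) fun A hA _ => ?_
  rw [setLIntegral_condLExp_trim hm _ _ hA, setLIntegral_trim hm hY hA]
  exact h A hA

variable {Ω : Type*} {T : ℝ} {X : Time T → Ω → ℝ}

theorem measurable_gridSup {m : MeasurableSpace Ω} {q : ℝ} {τ : ℕ → Time T} {k : ℕ} (N : ℕ)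
    (h : ∀ i j, k ≤ i → i ≤ j → Measurable[m] fun ω => X (τ j) ω - X (τ i) ω) :
    Measurable[m] (gridSup X q τ k N) := by
  unfold gridSup
  refine Measurable.iSup fun i => Measurable.iSup fun j => Measurable.iSup fun hi =>
    Measurable.iSup fun hij => Measurable.iSup fun _ => ?_
  exact ENNReal.measurable_ofReal.comp (Real.measurable_exp.comp ((h i j hi hij).const_mul q))

theorem measurable_incrementAlgebra_gridSup (q : ℝ) (τ : ℕ → Time T) (k N : ℕ) :
    Measurable[incrementAlgebra X fun j => τ (k + j)] (gridSup X q τ k N) := by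
  refine measurable_gridSup N fun i j hi hij => ?_
  have := measurable_incrementAlgebra (X := X) (fun j => τ (k + j)) (i := i - k) (j := j - k)
    (by omega)
  simpa only [Nat.add_sub_cancel' hi, Nat.add_sub_cancel' (hi.trans hij)] using this

theorem measurable_indicator_one {m : MeasurableSpace Ω} {A : Set Ω} (hA : MeasurableSet[m] A) :
    Measurable[m] (A.indicator (1 : Ω → ℝ≥0∞)) :=
  measurable_one.indicator hA

variable {ρ : Ω → Time T}

/-- A measurable majorant of `exp(q (X_t - X_u))`, `ρ ≤ u ≤ t`, obtained from grids. -/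
noncomputable def futureSup (hT : 0 < T) (X : Time T → Ω → ℝ) (q : ℝ) (ρ : Ω → Time T)
    (ω : Ω) : ℝ≥0∞ :=
  liminf (fun n => gridSup X q (gridTime hT n) (gridIndex n (ρ ω)) (n + 1) ω) atTop

/-- Rounding u and t up gives an admissible pair in every grid supremum, and right-continuity
recovers the increment in the limit. -/
theorem le_futureSup (hT : 0 < T) (hX : ∀ ω, IsCadlagPath fun t => X t ω) (q : ℝ) {ω : Ω}
    {u t : Time T} (hu : ρ ω ≤ u) (hut : u ≤ t) :
    ENNReal.ofReal (Real.exp (q * (X t ω - X u ω))) ≤ futureSup hT X q ρ ω := by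
  have h1 : ∀ s : Time T, Tendsto (fun n => X (gridTime hT n (gridIndex n s)) ω) atTop
      (𝓝 (X s ω)) := fun s => (hX ω s).1.tendsto.comp (tendsto_gridTime_gridIndex hT s)
  have hc : Continuous fun x : ℝ => ENNReal.ofReal (Real.exp (q * x)) :=
    ENNReal.continuous_ofReal.comp (by fun_prop)
  have h2 := (hc.tendsto _).comp ((h1 t).sub (h1 u))
  rw [← h2.liminf_eq]
  refine liminf_le_liminf (Eventually.of_forall fun n => ?_)
  exact le_iSup_of_le (gridIndex n u) (le_iSup_of_le (gridIndex n t)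
    (le_iSup_of_le (gridIndex_mono hT n hu) (le_iSup_of_le (gridIndex_mono hT n hut)
    (le_iSup_of_le (gridIndex_le hT n t) le_rfl))))

/-- This is `weight_le` with C the q-th root of `futureSup`; finiteness allows C to be real. -/
theorem iSup_weight_le (hT : 0 < T) (hX : ∀ ω, IsCadlagPath fun t => X t ω) {q : ℝ} (hq : 0 < q)
    {η : ℝ} (hη : η ∈ Set.Icc (0 : ℝ) 1) {ω : Ω} (hfin : futureSup hT X q ρ ω < ∞) :
    (⨆ (t : Time T) (_ : ρ ω ≤ t), ENNReal.ofReal (weight (price X) η t ω ^ q))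
      ≤ ENNReal.ofReal (weight (price X) η (ρ ω) ω ^ q) * futureSup hT X q ρ ω := by
  refine iSup₂_le fun t ht => ?_
  set w := (futureSup hT X q ρ ω).toReal with hw
  have hw0 : 0 ≤ w := ENNReal.toReal_nonneg
  have h1 : weight (price X) η t ω ≤ weight (price X) η (ρ ω) ω * w ^ q⁻¹ := by
    refine weight_le hX hη ht ω fun u hu hut => ?_
    have h2 := le_futureSup hT hX q hu hut
    rw [← ENNReal.ofReal_toReal hfin.ne, ENNReal.ofReal_le_ofReal_iff hw0] at h2
    have h3 := Real.rpow_le_rpow (Real.exp_nonneg _) h2 (inv_nonneg.2 hq.le)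
    rwa [← Real.exp_mul, mul_comm q, mul_assoc, mul_inv_cancel₀ hq.ne', mul_one] at h3
  rw [← ENNReal.ofReal_toReal hfin.ne, ← ENNReal.ofReal_mul (Real.rpow_nonneg (weight_nonneg _ _ _) _)]
  refine ENNReal.ofReal_le_ofReal ?_
  calc _ ≤ (weight (price X) η (ρ ω) ω * w ^ q⁻¹) ^ q :=
        Real.rpow_le_rpow (weight_nonneg _ _ _) h1 hq.le
    _ = _ := by
        rw [Real.mul_rpow (weight_nonneg _ _ _) (Real.rpow_nonneg hw0 _), ← Real.rpow_mul hw0,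
          inv_mul_cancel₀ hq.ne', Real.rpow_one]

variable [mΩ : MeasurableSpace Ω] {P : Measure Ω} [P.IsComplete]

/-- Independence factors the integral; starting the supremum at 0 instead of k then makes the bound
independent of k. -/
theorem IsLevyProcess.setLIntegral_gridSup_le (hX : IsLevyProcess P X) (q : ℝ) {τ : ℕ → Time T}
    (hτ : Monotone τ) (k N : ℕ) {A : Set Ω}
    (hA : MeasurableSet[augmentedFiltration P X hX.measurable (τ k)] A) :
    ∫⁻ ω in A, gridSup X q τ k N ω ∂P ≤ P A * ∫⁻ ω, gridSup X q τ 0 N ω ∂P := by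
  have hA' : MeasurableSet A := (augmentedFiltration P X hX.measurable).le _ _ hA
  have hind := hX.indep_augmentedFiltration (u := fun j => τ (k + j))
    fun i j hij => hτ (Nat.add_le_add_left hij k)
  have hmul := lintegral_mul_eq_lintegral_mul_lintegral_of_independent_measurableSpace
    ((augmentedFiltration P X hX.measurable).le _) (incrementAlgebra_le hX.measurable _) hind
    (f := A.indicator 1) (g := gridSup X q τ k N)
    (measurable_indicator_one (by simpa using hA))
    (measurable_incrementAlgebra_gridSup q τ k N)
  calc ∫⁻ ω in A, gridSup X q τ k N ω ∂P
      = ∫⁻ ω, A.indicator 1 ω * gridSup X q τ k N ω ∂P := by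
        rw [← lintegral_indicator hA']
        refine lintegral_congr fun ω => ?_
        by_cases h : ω ∈ A <;> simp [h]
    _ = P A * ∫⁻ ω, gridSup X q τ k N ω ∂P := by rw [hmul, lintegral_indicator_one hA']
    _ ≤ _ := by
        gcongr with ω
        exact gridSup_anti X q τ (Nat.zero_le k) N ω

theorem measurable_of_isStoppingTime {𝓕 : Filtration (Time T) mΩ}
    (hρ : IsStoppingTime 𝓕 fun ω => (ρ ω : WithTop (Time T))) : Measurable ρ := by
  refine measurable_of_Iic fun t => ?_
  have e : ρ ⁻¹' Set.Iic t = {ω | (ρ ω : WithTop (Time T)) ≤ t} := by ext; simp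
  rw [e]
  exact 𝓕.le t _ (hρ t)

theorem measurable_apply_nat {f : ℕ → Ω → ℝ≥0∞} (hf : ∀ k, Measurable (f k)) {k : Ω → ℕ}
    (hk : Measurable k) : Measurable fun ω => f (k ω) ω := by
  have h : Measurable fun p : ℕ × Ω => f p.1 p.2 := measurable_from_prod_countable_right hf
  exact h.comp (hk.prodMk measurable_id)

theorem measurable_gridSup_gridIndex (hm : ∀ t, Measurable (X t)) (q : ℝ) (τ : ℕ → Time T)
    (hρ : Measurable ρ) (n N : ℕ) :
    Measurable fun ω => gridSup X q τ (gridIndex n (ρ ω)) N ω :=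
  measurable_apply_nat (f := fun k => gridSup X q τ k N)
    (fun _ => measurable_gridSup (m := mΩ) N fun i j _ _ => (hm (τ j)).sub (hm (τ i)))
    ((measurable_gridIndex n).comp hρ)

theorem measurableSet_inter_gridIndex_eq (hT : 0 < T) {𝓕 : Filtration (Time T) mΩ}
    (hρ : IsStoppingTime 𝓕 fun ω => (ρ ω : WithTop (Time T))) {A : Set Ω}
    (hA : MeasurableSet[hρ.measurableSpace] A) {n k : ℕ} (hk : k ≤ n + 1) :
    MeasurableSet[𝓕 (gridTime hT n k)] (A ∩ {ω | gridIndex n (ρ ω) = k}) := by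
  have h : ∀ l ≤ k, MeasurableSet[𝓕 (gridTime hT n k)] (A ∩ {ω | gridIndex n (ρ ω) ≤ l}) := by
    intro l hl
    have h1 := 𝓕.mono (gridTime_mono hT n hl) _ (hA.2 (gridTime hT n l))
    simpa only [WithTop.coe_le_coe, le_gridTime_iff hT (hl.trans hk)] using h1
  have e : A ∩ {ω | gridIndex n (ρ ω) = k} = (A ∩ {ω | gridIndex n (ρ ω) ≤ k}) \
      ⋃ l ∈ Finset.range k, (A ∩ {ω | gridIndex n (ρ ω) ≤ l}) := by
    ext ω
    simp only [Set.mem_inter_iff, Set.mem_ofPred_eq, Set.mem_sdiff, Set.mem_iUnion,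
      Finset.mem_range, not_exists, not_and, exists_prop]
    constructor
    · rintro ⟨h1, h2⟩
      exact ⟨⟨h1, h2.le⟩, fun l hl _ => by omega⟩
    · rintro ⟨⟨h1, h2⟩, h3⟩
      refine ⟨h1, le_antisymm h2 (not_lt.1 fun h4 => h3 _ h4 h1 le_rfl)⟩
  rw [e]
  exact MeasurableSet.diff (h k le_rfl) (Finset.measurableSet_biUnion _ fun l hl =>
    h l (Finset.mem_range.1 hl).le)

/-- A is cut into slices on which the rounded stopping time is a constant grid point, and each slice
belongs to the past of that point. -/
theorem IsLevyProcess.setLIntegral_gridSup_gridIndex_le (hX : IsLevyProcess P X) (hT : 0 < T)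
    (q : ℝ) (hρ : IsStoppingTime (augmentedFiltration P X hX.measurable)
      fun ω => (ρ ω : WithTop (Time T))) (n : ℕ) {A : Set Ω}
    (hA : MeasurableSet[hρ.measurableSpace] A) :
    ∫⁻ ω in A, gridSup X q (gridTime hT n) (gridIndex n (ρ ω)) (n + 1) ω ∂P
      ≤ P A * ∫⁻ ω, gridSup X q (gridTime hT n) 0 (n + 1) ω ∂P := by
  have hA' : MeasurableSet A := hρ.measurableSpace_le _ hA
  let C : ℕ → Set Ω := fun k => A ∩ {ω | gridIndex n (ρ ω) = k}
  have hCm : ∀ k ∈ Finset.range (n + 2), MeasurableSet (C k) := fun k hk =>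
    (augmentedFiltration P X hX.measurable).le _ _ (measurableSet_inter_gridIndex_eq hT hρ hA
      (Nat.lt_succ_iff.1 (Finset.mem_range.1 hk)))
  have hU : A = ⋃ k ∈ Finset.range (n + 2), C k := by
    ext ω
    simp only [Set.mem_iUnion, Finset.mem_range, C, Set.mem_inter_iff, Set.mem_ofPred_eq]
    exact ⟨fun h => ⟨_, Nat.lt_succ_iff.2 (gridIndex_le hT n (ρ ω)), h, rfl⟩,
      fun ⟨_, _, h, _⟩ => h⟩
  have hd : Set.PairwiseDisjoint (↑(Finset.range (n + 2))) C := fun k _ l _ hkl =>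
    Set.disjoint_left.2 fun ω h1 h2 => hkl (h1.2.symm.trans h2.2)
  have hPA : P A = ∑ k ∈ Finset.range (n + 2), P (C k) := by
    conv_lhs => rw [hU]
    exact measure_biUnion_finset hd hCm
  calc ∫⁻ ω in A, gridSup X q (gridTime hT n) (gridIndex n (ρ ω)) (n + 1) ω ∂P
      = ∑ k ∈ Finset.range (n + 2),
          ∫⁻ ω in C k, gridSup X q (gridTime hT n) (gridIndex n (ρ ω)) (n + 1) ω ∂P := by
        conv_lhs => rw [hU]
        exact lintegral_biUnion_finset hd hCm _
    _ ≤ ∑ k ∈ Finset.range (n + 2),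
          P (C k) * ∫⁻ ω, gridSup X q (gridTime hT n) 0 (n + 1) ω ∂P := by
        refine Finset.sum_le_sum fun k hk => ?_
        have h1 : ∫⁻ ω in C k, gridSup X q (gridTime hT n) (gridIndex n (ρ ω)) (n + 1) ω ∂P
            = ∫⁻ ω in C k, gridSup X q (gridTime hT n) k (n + 1) ω ∂P :=
          setLIntegral_congr_fun (hCm k hk) fun ω hω => by
            have h2 : gridIndex n (ρ ω) = k := hω.2
            simp only [h2]
        rw [h1]
        exact hX.setLIntegral_gridSup_le q (gridTime_mono hT n) k (n + 1)
          (measurableSet_inter_gridIndex_eq hT hρ hA (Nat.lt_succ_iff.1 (Finset.mem_range.1 hk)))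
    _ = _ := by rw [← Finset.sum_mul, hPA]

theorem measurable_futureSup (hT : 0 < T) (hm : ∀ t, Measurable (X t)) (q : ℝ)
    (hρ : Measurable ρ) : Measurable (futureSup hT X q ρ) :=
  Measurable.liminf fun n => measurable_gridSup_gridIndex hm q (gridTime hT n) hρ n (n + 1)

theorem IsLevyProcess.setLIntegral_futureSup_le (hX : IsLevyProcess P X) (hT : 0 < T)
    {q : ℝ} (hρ : IsStoppingTime (augmentedFiltration P X hX.measurable)
      fun ω => (ρ ω : WithTop (Time T))) {A : Set Ω}
    (hA : MeasurableSet[hρ.measurableSpace] A) {B : ℝ≥0∞}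
    (hB : ∀ n, ∫⁻ ω, gridSup X q (gridTime hT n) 0 (n + 1) ω ∂P ≤ B) :
    ∫⁻ ω in A, futureSup hT X q ρ ω ∂P ≤ B * P A := by
  refine (lintegral_liminf_le fun n => measurable_gridSup_gridIndex hX.measurable q (gridTime hT n)
    (measurable_of_isStoppingTime hρ) n (n + 1)).trans ?_
  refine liminf_le_of_le (by isBoundedDefault) fun b hb => ?_
  obtain ⟨n, hn⟩ := hb.exists
  rw [mul_comm]
  exact hn.trans ((hX.setLIntegral_gridSup_gridIndex_le hT q hρ n hA).trans
    (mul_le_mul_right (hB n) _))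

variable [IsProbabilityMeasure P]

theorem IsLevyProcess.condLExp_weight_le (hX : IsLevyProcess P X) (hT : 0 < T)
    {q : ℝ} (hq : 0 < q) {η : ℝ} (hη : η ∈ Set.Icc (0 : ℝ) 1)
    (hρ : IsStoppingTime (augmentedFiltration P X hX.measurable)
      fun ω => (ρ ω : WithTop (Time T))) {B : ℝ≥0∞} (hBtop : B < ∞)
    (hB : ∀ n, ∫⁻ ω, gridSup X q (gridTime hT n) 0 (n + 1) ω ∂P ≤ B) :
    condLExp hρ.measurableSpace P
        (fun ω => ⨆ (t : Time T) (_ : ρ ω ≤ t), ENNReal.ofReal (weight (price X) η t ω ^ q))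
      ≤ᵐ[P] fun ω => B * ENNReal.ofReal (weight (price X) η (ρ ω) ω ^ q) := by
  have hle := hρ.measurableSpace_le
  have hcl := isCLPlus_weight (P := P) hT hX.measurable hX.cadlag η
  have hΦ := measurable_comp_stoppingTime hT hcl.adapted (fun ω t => (hcl.cadlag ω t).1) hρ
  have hG : Measurable[hρ.measurableSpace]
      fun ω => ENNReal.ofReal (weight (price X) η (ρ ω) ω ^ q) :=
    ENNReal.measurable_ofReal.comp (hΦ.pow_const q)
  have hWm := measurable_futureSup hT hX.measurable q (measurable_of_isStoppingTime hρ)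
  have hA := fun A (hA : MeasurableSet[hρ.measurableSpace] A) =>
    hX.setLIntegral_futureSup_le hT hρ hA hB
  -- The bound for the whole space shows that the majorant is integrable.
  have hfin : ∀ᵐ ω ∂P, futureSup hT X q ρ ω < ∞ := by
    refine ae_lt_top hWm (ne_top_of_le_ne_top hBtop.ne ?_)
    simpa using hA Set.univ MeasurableSet.univ
  refine condLExp_le_of_setLIntegral_le hle (hG.const_mul B) fun A hAm => ?_
  have hA' : MeasurableSet A := hle _ hAm
  calc _ ≤ ∫⁻ ω in A, ENNReal.ofReal (weight (price X) η (ρ ω) ω ^ q) * futureSup hT X q ρ ω ∂P :=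
        lintegral_mono_ae (ae_restrict_of_ae (hfin.mono fun ω hω =>
          iSup_weight_le hT hX.cadlag hq hη hω))
    _ = ∫⁻ ω, A.indicator (fun ω => ENNReal.ofReal (weight (price X) η (ρ ω) ω ^ q)) ω
          * futureSup hT X q ρ ω ∂P := by
        rw [← lintegral_indicator hA']
        refine lintegral_congr fun ω => ?_
        by_cases h : ω ∈ A <;> simp [h]
    _ ≤ B * ∫⁻ ω, A.indicator (fun ω => ENNReal.ofReal (weight (price X) η (ρ ω) ω ^ q)) ω ∂P :=
        lintegral_mul_le_of_setLIntegral_le hle (hG.indicator hAm) hWm hA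
    _ = _ := by
        rw [lintegral_indicator hA', lintegral_const_mul _ (hG.mono hle le_rfl)]

end StoppingTimes

end ExpLevy

/-! ### The bound for the SM_q norm. -/

theorem mainTheorem12 {Ω : Type*} [MeasurableSpace Ω] (P : Measure Ω) [IsProbabilityMeasure P]
    [P.IsComplete] (T : ℝ) (hT : 0 < T) (X : ExpLevy.Time T → Ω → ℝ)
    (hX : ExpLevy.IsLevyProcess P X) (γ σ : ℝ) (ν : Measure ℝ)
    (htriplet : ExpLevy.HasCharacteristicTriplet P X γ σ ν) (q : ℝ) (hq : 1 < q)
    (hν : ∫⁻ x in {x : ℝ | 1 < |x|}, ENNReal.ofReal (Real.exp (q * x)) ∂ν < ∞) :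
    ∀ η ∈ Set.Icc (0 : ℝ) 1,
      ExpLevy.MemSM P (ExpLevy.augmentedFiltration P X hX.measurable) q
          (ExpLevy.weight (ExpLevy.price X) η) ∧
        ExpLevy.smNorm P (ExpLevy.augmentedFiltration P X hX.measurable) q
            (ExpLevy.weight (ExpLevy.price X) η) ^ q
          ≤ ENNReal.ofReal
              (Real.exp (T * ‖ExpLevy.charExponent γ σ ν (-Complex.I)‖ * (2 * q + 1))
                * 2 ^ (1 - η) * (q / (q - 1)) ^ (2 * q))
            * eLpNorm (ExpLevy.price X ⟨T, Set.right_mem_Icc.2 hT.le⟩) (ENNReal.ofReal q) P ^ q := by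
  intro η hη
  have hq0 : 0 < q := by linarith
  have hc : 0 ≤ q / (q - 1) := div_nonneg hq0.le (by linarith)
  set M := ‖ExpLevy.charExponent γ σ ν (-Complex.I)‖ with hM
  have hM0 : 0 ≤ M := norm_nonneg _
  have hTt : ∀ n, ExpLevy.gridTime hT n (n + 1) = ⟨T, Set.right_mem_Icc.2 hT.le⟩ := fun n =>
    Subtype.ext (by rw [ExpLevy.coe_gridTime hT le_rfl]; push_cast; field_simp)
  set tT : ExpLevy.Time T := ⟨T, Set.right_mem_Icc.2 hT.le⟩
  set E := ∫ ω, Real.exp (q * X tT ω) ∂P with hE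
  have hE0 : 0 ≤ E := integral_nonneg fun ω => Real.exp_nonneg _
  have hEnorm : eLpNorm (ExpLevy.price X tT) (ENNReal.ofReal q) P ^ q = ENNReal.ofReal E := by
    rw [eLpNorm_eq_lintegral_rpow_enorm_toReal (by simpa using hq0) ENNReal.ofReal_ne_top,
      ENNReal.toReal_ofReal hq0.le, ← ENNReal.rpow_mul, one_div, inv_mul_cancel₀ hq0.ne',
      ENNReal.rpow_one, hE, ofReal_integral_eq_lintegral_ofReal
        (htriplet.exp_moments hX.measurable hq hν tT).1 (ae_of_all _ fun ω => Real.exp_nonneg _)]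
    refine lintegral_congr fun ω => ?_
    rw [ExpLevy.price, Real.enorm_eq_ofReal (Real.exp_nonneg _),
      ENNReal.ofReal_rpow_of_nonneg (Real.exp_nonneg _) hq0.le, ← Real.exp_mul, mul_comm]
  set D := Real.exp (2 * q * T * M) * (q / (q - 1)) ^ (2 * q) * E with hD
  have hD0 : 0 ≤ D := mul_nonneg (mul_nonneg (Real.exp_nonneg _) (Real.rpow_nonneg hc _)) hE0
  have hgrid : ∀ n, ∫⁻ ω, ExpLevy.gridSup X q (ExpLevy.gridTime hT n) 0 (n + 1) ω ∂P
      ≤ ENNReal.ofReal D := fun n => by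
    have h := ExpLevy.lintegral_gridSup_le hX htriplet hq hν (ExpLevy.gridTime_mono hT n) (n + 1)
      (by rw [ExpLevy.coe_gridTime hT (Nat.zero_le _)]; simp) (by rw [hTt])
    rwa [hTt] at h
  -- The admissible constant is c = D^(1/q), so that c^q = D.
  have hnorm : ExpLevy.smNorm P (ExpLevy.augmentedFiltration P X hX.measurable) q
      (ExpLevy.weight (ExpLevy.price X) η) ≤ ((Real.toNNReal D ^ q⁻¹ : ℝ≥0) : ℝ≥0∞) := by
    refine iInf₂_le _ fun ρ hρ => ?_
    have h := hX.condLExp_weight_le hT hq0 hη hρ ENNReal.ofReal_lt_top hgrid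
    rw [← ENNReal.coe_rpow_of_nonneg _ hq0.le, ← NNReal.rpow_mul, inv_mul_cancel₀ hq0.ne',
      NNReal.rpow_one]
    exact h
  refine ⟨⟨ExpLevy.isCLPlus_weight hT hX.measurable hX.cadlag η,
    hnorm.trans_lt ENNReal.coe_lt_top⟩, ?_⟩
  calc _ ≤ ((Real.toNNReal D ^ q⁻¹ : ℝ≥0) : ℝ≥0∞) ^ q := ENNReal.rpow_le_rpow hnorm hq0.le
    _ = ENNReal.ofReal D := by
        rw [← ENNReal.coe_rpow_of_nonneg _ hq0.le, ← NNReal.rpow_mul, inv_mul_cancel₀ hq0.ne',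
          NNReal.rpow_one]
        rfl
    _ ≤ _ := by
        rw [hEnorm, hD, ENNReal.ofReal_mul (mul_nonneg (Real.exp_nonneg _) (Real.rpow_nonneg hc _))]
        gcongr ENNReal.ofReal ?_ * _
        -- D has no factor 2^(1−η) and only 2q in the exponential; both are enlarged to reach the
        -- stated constant.
        have h2 : (1 : ℝ) ≤ 2 ^ (1 - η) :=
          Real.one_le_rpow (by norm_num) (by linarith [hη.2])
        have h3 : Real.exp (2 * q * T * M) ≤ Real.exp (T * M * (2 * q + 1)) := by
          refine Real.exp_le_exp.2 ?_
          nlinarith [mul_nonneg hT.le hM0]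
        refine mul_le_mul_of_nonneg_right ?_ (Real.rpow_nonneg hc _)
        calc _ ≤ Real.exp (T * M * (2 * q + 1)) * 1 := by rw [mul_one]; exact h3
          _ ≤ _ := by gcongr
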